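/- **Setting.** Let $\mathcal F:\ \emptyset=K_0\leftrightarrow K_1\leftrightarrow\cdots\leftrightarrow K_m$ be a simplex-wise zigzag filtration: each $K_i$ is a finite abstract simplicial complex, and each arrow is either a forward inclusion $K_i\hookrightarrow K_{i+1}$ that adds exactly one simplex or a backward inclusion $K_i\hookleftarrow K_{i+1}$ that deletes exactly one simplex. All chains have $\mathbb Z_2$ coefficients and are regarded as chains of the total complex $\bigcup_i K_i$. Let $\mathsf Z(K_i)$, $\mathsf B(K_i)$ and $\mathsf H(K_i)=\mathsf Z(K_i)/\mathsf B(K_i)$ be the cycle, boundary and homology groups over all degrees. The homology zigzag module $\mathsf H(\mathcal F)$ consists of the spaces $\mathsf H(K_i)$ with the maps $\psi_i^*$ induced by the inclusions, and the boundary zigzag module $\mathsf B(\mathcal F)$ consists of the spaces $\mathsf B(K_i)$ with the inclusions $\psi^\#_i$. The barcode of a zigzag module is the multiset of intervals $[b,d]\subseteq\{0,\dots,m\}$ in a decomposition of it into interval modules; $\mathsf{Pers}^H(\mathcal F)$ and $\mathsf{Pers}^B(\mathcal F)$ denote the barcodes of $\mathsf H(\mathcal F)$ and $\mathsf B(\mathcal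 F)$. *Birth and death indices.* For $0\le j<m$: if $\psi^*_j$ is forward, then $j+1\in\mathsf P^H$ if $\psi_j^*$ is injective, and $j\in\mathsf N^H$ otherwise; if $\psi^*_j$ is backward, then $j+1\in \mathsf P^H$ if $\psi^*_j$ is surjective, and $j\in\mathsf N^H$ otherwise. If $\psi^\#_j$ is forward and not surjective, then $j+1\in\mathsf P^B$; if it is backward and not surjective, then $j\in\mathsf N^B$. Finally, $\dim\mathsf H(K_m)$ copies of $m$ are added to the multiset $\mathsf N^H$ and $\dim\mathsf B(K_m)$ copies of $m$ to the multiset $\mathsf N^B$. *Representatives.* A homology representative for $[b,d]$, where $b\in\mathsf P^H$ and $d\in\mathsf N^H$, is a sequence of cycles $z_\alpha\in\mathsf Z(K_\alpha)$, $\alpha\in[b,d]$, all of the same degree $p$, such that for $b\le\alpha<d$ the map $\psi^*_\alpha$ matches $[z_\alpha]$ and $[z_{\alpha+1}]$ (in its direction), and such that: if $\psi^*_{b-1}$ is forward, then $z_b\notin\mathsf Z(K_{b-1})$, and if it is backward, then $[z_b]$ is a nonzero element of $\ker\psi^*_{b-1}$; if $d<m$ and $\psi^*_d$ is backward, then $z_d\notin\mathsf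 Z(K_{d+1})$, and if $d<m$ and $\psi^*_d$ is forward, then $[z_d]$ is a nonzero element of $\ker\psi^*_d$. A boundary representative for $[b,d]$, where $b\in\mathsf P^B$ and $d\in\mathsf N^B$, is a sequence of boundaries $z_\alpha\in\mathsf B(K_\alpha)$, $\alpha\in[b,d]$, all of the same degree $p$, with $z_{\alpha+1}=z_\alpha$ for $b\le\alpha<d$, $z_b\notin\mathsf B(K_{b-1})$, and $z_d\notin\mathsf B(K_{d+1})$ if $d<m$. *Wires.* A wire at an index $\iota\in\mathsf P^H\cup\mathsf P^B$ is a cycle $w_\iota\in\mathsf Z(K_\iota)$ such that (i) $K_{\iota-1}\hookrightarrow K_\iota$ is forward and $w_\iota\notin\mathsf Z(K_{\iota-1})$, or (ii) $K_{\iota-1}\hookleftarrow K_\iota$ is backward and $w_\iota\in\mathsf B(K_{\iota-1})\setminus\mathsf B(K_\iota)$, or (iii) $K_{\iota-1}\hookrightarrow K_\iota$ is forward and $w_\iota\in\mathsf B(K_\iota)\setminus\mathsf B(K_{\iota-1})$. **Theorem.** For every simplex-wise zigzag filtration $\mathcal F$ there is a single family of wires $W=\{w_\iota\mid\iota\in\mathsf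 P^H\cup\mathsf P^B\}$, one at each birth index, such that for every $[b,d]\in\mathsf{Pers}^H(\mathcal F)$ (respectively $[b,d]\in\mathsf{Pers}^B(\mathcal F)$) there is a set of indices $J\subseteq\mathsf P^H\cup\mathsf P^B$ for which the chains $$z_\alpha=\sum_{\iota\in J,\ \iota\le\alpha}w_\iota,\qquad \alpha\in[b,d],$$ form a homology (respectively boundary) representative for $[b,d]$. Moreover, the barcodes $\mathsf{Pers}^H(\mathcal F)$ and $\mathsf{Pers}^B(\mathcal F)$ exist and are unique, and each of them pairs births with deaths: the left endpoints of the intervals in $\mathsf{Pers}^H(\mathcal F)$ are the elements of $\mathsf P^H$, each occurring exactly once, and the right endpoints form the multiset $\mathsf N^H$; likewise for $\mathsf{Pers}^B(\mathcal F)$ with $\mathsf P^B$ and $\mathsf N^B$. -/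

import Mathlib

noncomputable section

namespace WireZigzag

/-! Simplicial chains with coefficients in the field with two elements.  A (not necessarily full)
abstract simplicial complex on a vertex type `V` is Mathlib's `PreAbstractSimplicialComplex V`: a
set of nonempty finite subsets of `V`, closed under passing to nonempty subsets. -/

/-- Chains over `ℤ/2` on all finite subsets of `V`; the chains of each complex, and those of the
total complex of a filtration, form subspaces of this space. -/
abbrev Chain (V : Type*) := Finset V →₀ ZMod 2

/-- The boundary operator: a simplex is sent to the sum of its nonempty faces of codimension one
(so the boundary of a vertex is `0`). -/
def boundaryMap (V : Type*) : Chain V →ₗ[ZMod 2] Chain V :=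
  Finsupp.linearCombination (ZMod 2) fun σ : Finset V =>
    ∑ τ ∈ (σ.powersetCard (σ.card - 1)).filter (fun τ => τ.Nonempty), Finsupp.single τ (1 : ZMod 2)

/-- The chains of dimension `p`, that is, the sums of simplices with `p + 1` vertices. -/
def chainsOfDim (V : Type*) (p : ℕ) : Submodule (ZMod 2) (Chain V) :=
  Finsupp.supported (ZMod 2) (ZMod 2) {σ : Finset V | σ.card = p + 1}

section Complex

variable {V : Type*}

/-- The chain group `C(K)`, over all degrees. -/
def chainGroup (K : PreAbstractSimplicialComplex V) : Submodule (ZMod 2) (Chain V) :=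
  Finsupp.supported (ZMod 2) (ZMod 2) K.faces

/-- The cycle group `Z(K)`, over all degrees. -/
def cycleGroup (K : PreAbstractSimplicialComplex V) : Submodule (ZMod 2) (Chain V) :=
  chainGroup K ⊓ LinearMap.ker (boundaryMap V)

/-- The boundary group `B(K)`, over all degrees. -/
def boundaryGroup (K : PreAbstractSimplicialComplex V) : Submodule (ZMod 2) (Chain V) :=
  (chainGroup K).map (boundaryMap V)

/-- The boundaries of `K`, as a subspace of `Z(K)`.  (The additive structure of `Z(K)` is spelled
out to help instance search; it is the usual one.) -/
def boundariesInCycles (K : PreAbstractSimplicialComplex V) :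
    @Submodule (ZMod 2) (cycleGroup K) _ AddCommGroup.toAddCommMonoid _ :=
  (boundaryGroup K).submoduleOf (cycleGroup K)

/-- The homology group `H(K) = Z(K) / B(K)`, over all degrees. -/
abbrev Homology (K : PreAbstractSimplicialComplex V) :=
  cycleGroup K ⧸ boundariesInCycles K

/-- The homology class of a cycle. -/
def homologyClass (K : PreAbstractSimplicialComplex V) (z : Chain V) (hz : z ∈ cycleGroup K) :
    Homology K :=
  Submodule.Quotient.mk (⟨z, hz⟩ : cycleGroup K)

theorem chainGroup_mono {K L : PreAbstractSimplicialComplex V} (h : K.faces ⊆ L.faces) :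
    chainGroup K ≤ chainGroup L :=
  Finsupp.supported_mono h

theorem cycleGroup_mono {K L : PreAbstractSimplicialComplex V} (h : K.faces ⊆ L.faces) :
    cycleGroup K ≤ cycleGroup L :=
  inf_le_inf_right _ (chainGroup_mono h)

theorem boundaryGroup_mono {K L : PreAbstractSimplicialComplex V} (h : K.faces ⊆ L.faces) :
    boundaryGroup K ≤ boundaryGroup L :=
  Submodule.map_mono (chainGroup_mono h)

/-- The map `H(K) → H(L)` induced by an inclusion of complexes. -/
def homologyMap {K L : PreAbstractSimplicialComplex V} (h : K.faces ⊆ L.faces) :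
    Homology K →ₗ[ZMod 2] Homology L :=
  Submodule.mapQ _ _ (Submodule.inclusion (cycleGroup_mono h))
    (fun _ hx => boundaryGroup_mono h hx)

/-- The inclusion `B(K) → B(L)` induced by an inclusion of complexes. -/
def boundaryInclusion {K L : PreAbstractSimplicialComplex V} (h : K.faces ⊆ L.faces) :
    boundaryGroup K →ₗ[ZMod 2] boundaryGroup L :=
  Submodule.inclusion (boundaryGroup_mono h)

/-- `L` arises from `K` by the addition of a single simplex. -/
def AddsSimplex (K L : PreAbstractSimplicialComplex V) : Prop :=
  ∃ σ : Finset V, σ ∉ K.faces ∧ L.faces = insert σ K.faces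

end Complex

/-! Zigzag modules and their barcodes. -/

/-- A zigzag module of length `m` over `ℤ/2`: spaces `X 0, …, X m` and, for each `i < m`, a linear
map `X i → X (i+1)` if `fwd i` holds and a linear map `X (i+1) → X i` otherwise.  Spaces with an
index above `m` play no role. -/
structure ZigzagModule (m : ℕ) (fwd : ℕ → Prop) where
  X : ℕ → Type*
  [instAddCommGroup : ∀ i, AddCommGroup (X i)]
  [instModule : ∀ i, Module (ZMod 2) (X i)]
  forward : ∀ i, i < m → fwd i → (X i →ₗ[ZMod 2] X (i + 1))
  backward : ∀ i, i < m → ¬ fwd i → (X (i + 1) →ₗ[ZMod 2] X i)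

attribute [instance] ZigzagModule.instAddCommGroup ZigzagModule.instModule

namespace ZigzagModule

variable {m : ℕ} {fwd : ℕ → Prop}

/-- An isomorphism of zigzag modules. -/
structure Iso (M N : ZigzagModule m fwd) where
  equiv : ∀ i, i ≤ m → (M.X i ≃ₗ[ZMod 2] N.X i)
  comm_forward : ∀ (i : ℕ) (hi : i < m) (hf : fwd i) (x : M.X i),
    equiv (i + 1) hi (M.forward i hi hf x) = N.forward i hi hf (equiv i hi.le x)
  comm_backward : ∀ (i : ℕ) (hi : i < m) (hf : ¬ fwd i) (x : M.X (i + 1)),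
    equiv i hi.le (M.backward i hi hf x) = N.backward i hi hf (equiv (i + 1) hi x)

/-- The direct sum of a finite family of zigzag modules (finite direct sums of vector spaces are
finite products). -/
def directSum {n : ℕ} (M : Fin n → ZigzagModule m fwd) : ZigzagModule m fwd where
  X i := ∀ k, (M k).X i
  forward i hi hf := LinearMap.pi fun k => (M k).forward i hi hf ∘ₗ LinearMap.proj k
  backward i hi hf := LinearMap.pi fun k => (M k).backward i hi hf ∘ₗ LinearMap.proj k

/-- The space at index `i` of the interval module over `[b,d]`: the field itself if `i ∈ [b,d]`,
and `0` otherwise. -/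
def intervalSpace (b d i : ℕ) : Submodule (ZMod 2) (ZMod 2) :=
  if b ≤ i ∧ i ≤ d then ⊤ else ⊥

/-- The map between the spaces of the interval module at the indices `i` and `j`: the identity if
both indices lie in `[b,d]`, and `0` otherwise. -/
def intervalMap (b d i j : ℕ) : intervalSpace b d i →ₗ[ZMod 2] intervalSpace b d j :=
  if h : b ≤ j ∧ j ≤ d then
    Submodule.inclusion (le_top.trans_eq (show ⊤ = intervalSpace b d j from (if_pos h).symm))
  else 0

/-- The interval module over `[b,d]`. -/
def intervalModule (m : ℕ) (fwd : ℕ → Prop) (b d : ℕ) : ZigzagModule m fwd where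
  X i := intervalSpace b d i
  forward i _ _ := intervalMap b d i (i + 1)
  backward i _ _ := intervalMap b d (i + 1) i

/-- `S` is the multiset of intervals `[b,d] ⊆ {0, …, m}` (encoded as pairs `(b, d)`) of a
decomposition of `M` into interval modules. -/
def IsBarcode (M : ZigzagModule m fwd) (S : Multiset (ℕ × ℕ)) : Prop :=
  ∃ (n : ℕ) (I : Fin n → ℕ × ℕ),
    Finset.univ.val.map I = S ∧
    (∀ k, (I k).1 ≤ (I k).2 ∧ (I k).2 ≤ m) ∧
    Nonempty (Iso M (directSum fun k => intervalModule m fwd (I k).1 (I k).2))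

end ZigzagModule

/-! Simplex-wise zigzag filtrations. -/

/-- A simplex-wise zigzag filtration `∅ = K 0 ↔ K 1 ↔ ⋯ ↔ K m`: each arrow is the addition or the
deletion of one simplex.  Complexes with an index above `m` play no role. -/
structure Filtration (V : Type*) (m : ℕ) where
  K : ℕ → PreAbstractSimplicialComplex V
  empty : (K 0).faces = ∅
  step : ∀ i, i < m → AddsSimplex (K i) (K (i + 1)) ∨ AddsSimplex (K (i + 1)) (K i)

namespace Filtration

variable {V : Type*} {m : ℕ} (F : Filtration V m)

/-- The arrow between `K i` and `K (i+1)` is a forward inclusion. -/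
def Forward (i : ℕ) : Prop := (F.K i).faces ⊆ (F.K (i + 1)).faces

theorem subset_of_not_forward {i : ℕ} (hi : i < m) (h : ¬ F.Forward i) :
    (F.K (i + 1)).faces ⊆ (F.K i).faces := by
  rcases F.step i hi with ⟨σ, _, hσ⟩ | ⟨σ, _, hσ⟩
  · exact absurd (show (F.K i).faces ⊆ (F.K (i + 1)).faces from hσ ▸ Set.subset_insert _ _) h
  · exact hσ ▸ Set.subset_insert _ _

/-- The homology zigzag module `H(F)`. -/
def homologyModule : ZigzagModule m F.Forward where
  X i := Homology (F.K i)
  forward _ _ hf := homologyMap hf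
  backward _ hi hf := homologyMap (F.subset_of_not_forward hi hf)

/-- The boundary zigzag module `B(F)`. -/
def boundaryModule : ZigzagModule m F.Forward where
  X i := boundaryGroup (F.K i)
  forward _ _ hf := boundaryInclusion hf
  backward _ hi hf := boundaryInclusion (F.subset_of_not_forward hi hf)

open Classical in
/-- The homology birth indices `P^H(F)`: the indices `j + 1` such that the homology map at `j` is
forward and injective, or backward and surjective. -/
def homologyBirths : Finset ℕ :=
  ((Finset.range m).filter fun j => ∃ hj : j < m,
    (∃ hf : F.Forward j, Function.Injective (F.homologyModule.forward j hj hf)) ∨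
    (∃ hf : ¬ F.Forward j, Function.Surjective (F.homologyModule.backward j hj hf))).image
      fun j => j + 1

open Classical in
/-- The multiset `N^H(F)` of homology death indices: the indices `j < m` such that the homology map
at `j` is forward and not injective, or backward and not surjective, and `dim H(K m)` copies of
`m`. -/
def homologyDeaths : Multiset ℕ :=
  ((Finset.range m).filter fun j => ∃ hj : j < m,
    (∃ hf : F.Forward j, ¬ Function.Injective (F.homologyModule.forward j hj hf)) ∨
    (∃ hf : ¬ F.Forward j, ¬ Function.Surjective (F.homologyModule.backward j hj hf))).val +
  Multiset.replicate (Module.finrank (ZMod 2) (Homology (F.K m))) m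

open Classical in
/-- The boundary birth indices `P^B(F)`: the indices `j + 1` such that the inclusion of boundary
groups at `j` is forward and not surjective. -/
def boundaryBirths : Finset ℕ :=
  ((Finset.range m).filter fun j => ∃ hj : j < m, ∃ hf : F.Forward j,
    ¬ Function.Surjective (F.boundaryModule.forward j hj hf)).image fun j => j + 1

open Classical in
/-- The multiset `N^B(F)` of boundary death indices: the indices `j < m` such that the inclusion of
boundary groups at `j` is backward and not surjective, and `dim B(K m)` copies of `m`. -/
def boundaryDeaths : Multiset ℕ :=
  ((Finset.range m).filter fun j => ∃ hj : j < m, ∃ hf : ¬ F.Forward j,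
    ¬ Function.Surjective (F.boundaryModule.backward j hj hf)).val +
  Multiset.replicate (Module.finrank (ZMod 2) (boundaryGroup (F.K m))) m

/-- The cycles `z α`, `α ∈ [b,d]`, form a homology representative for the interval `[b,d]`.
Values of `z` outside `[b,d]` play no role. -/
structure IsHomologyRep (b d : ℕ) (z : ℕ → Chain V) : Prop where
  birth_mem : b ∈ F.homologyBirths
  death_mem : d ∈ F.homologyDeaths
  birth_le_death : b ≤ d
  death_le : d ≤ m
  cycle : ∀ α, b ≤ α → α ≤ d → z α ∈ cycleGroup (F.K α)
  homogeneous : ∃ p, ∀ α, b ≤ α → α ≤ d → z α ∈ chainsOfDim V p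
  compat_forward : ∀ (α : ℕ) (hb : b ≤ α) (hd : α < d) (hf : F.Forward α),
    F.homologyModule.forward α (hd.trans_le death_le) hf
        (homologyClass (F.K α) (z α) (cycle α hb hd.le)) =
      homologyClass (F.K (α + 1)) (z (α + 1)) (cycle (α + 1) (Nat.le_succ_of_le hb) hd)
  compat_backward : ∀ (α : ℕ) (hb : b ≤ α) (hd : α < d) (hf : ¬ F.Forward α),
    F.homologyModule.backward α (hd.trans_le death_le) hf
        (homologyClass (F.K (α + 1)) (z (α + 1)) (cycle (α + 1) (Nat.le_succ_of_le hb) hd)) =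
      homologyClass (F.K α) (z α) (cycle α hb hd.le)
  birth_forward : ∀ j, j + 1 = b → F.Forward j → z b ∉ cycleGroup (F.K j)
  birth_backward : ∀ (j : ℕ) (hj : j + 1 = b) (hf : ¬ F.Forward j),
    homologyClass (F.K (j + 1)) (z (j + 1)) (cycle (j + 1) hj.ge (hj.trans_le birth_le_death)) ≠ 0 ∧
    F.homologyModule.backward j (hj.trans_le (birth_le_death.trans death_le)) hf
      (homologyClass (F.K (j + 1)) (z (j + 1))
        (cycle (j + 1) hj.ge (hj.trans_le birth_le_death))) = 0
  death_backward : d < m → ¬ F.Forward d → z d ∉ cycleGroup (F.K (d + 1))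
  death_forward : ∀ (hd : d < m) (hf : F.Forward d),
    homologyClass (F.K d) (z d) (cycle d birth_le_death le_rfl) ≠ 0 ∧
    F.homologyModule.forward d hd hf
      (homologyClass (F.K d) (z d) (cycle d birth_le_death le_rfl)) = 0

/-- The cycles `z α`, `α ∈ [b,d]`, form a boundary representative for the interval `[b,d]`.
Values of `z` outside `[b,d]` play no role. -/
structure IsBoundaryRep (b d : ℕ) (z : ℕ → Chain V) : Prop where
  birth_mem : b ∈ F.boundaryBirths
  death_mem : d ∈ F.boundaryDeaths
  birth_le_death : b ≤ d
  death_le : d ≤ m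
  boundary : ∀ α, b ≤ α → α ≤ d → z α ∈ boundaryGroup (F.K α)
  homogeneous : ∃ p, ∀ α, b ≤ α → α ≤ d → z α ∈ chainsOfDim V p
  compat : ∀ α, b ≤ α → α < d → z (α + 1) = z α
  birth : ∀ j, j + 1 = b → z b ∉ boundaryGroup (F.K j)
  death : d < m → z d ∉ boundaryGroup (F.K (d + 1))

/-- `z` is a wire with starting index `i`. -/
def IsWire (i : ℕ) (z : Chain V) : Prop :=
  i ∈ F.homologyBirths ∪ F.boundaryBirths ∧ z ∈ cycleGroup (F.K i) ∧
  ∃ j, j + 1 = i ∧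
    ((F.Forward j ∧ z ∉ cycleGroup (F.K j)) ∨
     (¬ F.Forward j ∧ z ∈ boundaryGroup (F.K j) ∧ z ∉ boundaryGroup (F.K i)) ∨
     (F.Forward j ∧ z ∈ boundaryGroup (F.K i) ∧ z ∉ boundaryGroup (F.K j)))

end Filtration

/-- The sequence of chains generated by the wires `w j`, `j ∈ J`: at index `α` it is the sum of the
`w j` with `j ∈ J` and `j ≤ α`. -/
def bundleSum {V : Type*} (w : ℕ → Chain V) (J : Finset ℕ) (α : ℕ) : Chain V :=
  ∑ j ∈ J.filter (fun j => j ≤ α), w j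

end WireZigzag

end

/-! Adding a simplex enlarges either the cycles or the boundaries by one homogeneous chain, and
removing one undoes this. Sweeping the filtration from left to right, one keeps for every bar that
is still alive a set of wires whose sum represents a class at the current index; these classes form
a basis of the homology there. At a birth a new bar starts with its own wire. At a death the classes
of some bars become dependent, or some cycles cease to be cycles, and exactly one bar has to end,
after bundles of wires of some bars have been added to others. The bundle of the bar born at `b'`
may be added to that of the bar born at `b` only if, from `b` on, it contributes cycles that keep
the representative valid at the birth of `b`; this defines a linear order on the births. When a
boundary is gained, the vanishing combination replaces the largest of its bars, which ends; when a
cycle is lost, the smallest of the bars with a lost cycle ends and is added to the other such bars.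

The boundary module is the same situation with the cycles replaced by the boundaries and the
boundaries by `0`. Intervals containing a given `[b, d]` are counted by the rank of the pairing of
compatible families of vectors over `[b, d]` with compatible families of linear forms, whence the
uniqueness of the barcode. -/

noncomputable section

namespace WireZigzag

open Finset

theorem multiset_eq_of_countP_le_eq {α : Type*} [PartialOrder α] [DecidableLE α] {S T : Multiset α}
    (h : ∀ a ∈ S + T, S.countP (a ≤ ·) = T.countP (a ≤ ·)) : S = T := by
  classical
  induction hn : S.card generalizing S T with
  | zero =>
    obtain rfl := Multiset.card_eq_zero.1 hn
    refine (Multiset.eq_zero_of_forall_notMem fun a ha => ?_).symm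
    have hcount := h a (by simpa using ha)
    rw [Multiset.countP_zero, eq_comm, Multiset.countP_eq_zero] at hcount
    exact hcount a ha le_rfl
  | succ n ih =>
    have hne : (S + T).toFinset.Nonempty := by
      rw [Multiset.toFinset_nonempty, ← Multiset.card_pos, Multiset.card_add, hn]
      lia
    obtain ⟨a, haST, hmax⟩ := (S + T).toFinset.exists_maximal hne
    rw [Multiset.mem_toFinset] at haST
    have hcount : ∀ U ≤ S + T, U.countP (a ≤ ·) = U.count a := fun U hU =>
      Multiset.countP_congr rfl fun x hx =>
        propext ⟨fun hax => hax.antisymm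
          (hmax (Multiset.mem_toFinset.2 (Multiset.mem_of_le hU hx)) hax), le_of_eq⟩
    have hmem : a ∈ S ↔ a ∈ T := by
      rw [← Multiset.count_pos, ← Multiset.count_pos, ← hcount S (Multiset.le_add_right S T),
        ← hcount T (Multiset.le_add_left T S), h a haST]
    have haS : a ∈ S := (Multiset.mem_add.1 haST).elim id hmem.2
    obtain ⟨S, rfl⟩ := Multiset.exists_cons_of_mem haS
    obtain ⟨T, rfl⟩ := Multiset.exists_cons_of_mem (hmem.1 haS)
    refine congrArg (a ::ₘ ·) (ih (fun x hx => ?_) (by simpa using hn))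
    have hx' := h x ((Multiset.mem_add.1 hx).elim (by simp +contextual) (by simp +contextual))
    rwa [Multiset.countP_cons, Multiset.countP_cons, Nat.add_right_cancel_iff] at hx'

namespace ZigzagModule

variable {m : ℕ} {fwd : ℕ → Prop} {M N : ZigzagModule m fwd} {b d : ℕ}

/-- The inverse of an isomorphism of zigzag modules. -/
def Iso.symm (e : Iso M N) : Iso N M where
  equiv i hi := (e.equiv i hi).symm
  comm_forward i hi hf x := by
    rw [LinearEquiv.symm_apply_eq, e.comm_forward, LinearEquiv.apply_symm_apply]
  comm_backward i hi hf x := by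
    rw [LinearEquiv.symm_apply_eq, e.comm_backward, LinearEquiv.apply_symm_apply]

/-- The composition of isomorphisms of zigzag modules. -/
def Iso.trans {O : ZigzagModule m fwd} (e : Iso M N) (f : Iso N O) : Iso M O where
  equiv i hi := (e.equiv i hi).trans (f.equiv i hi)
  comm_forward i hi hf x := by simp only [LinearEquiv.trans_apply, e.comm_forward, f.comm_forward]
  comm_backward i hi hf x := by
    simp only [LinearEquiv.trans_apply, e.comm_backward, f.comm_backward]

/-- A section of `M` over `[b,d]`: elements `s i`, `i ∈ [b,d]`, matched by the arrows, that is, an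
element of the limit of the restriction of `M` to `[b,d]`. Values outside `[b,d]` play no role. -/
structure IsSection (M : ZigzagModule m fwd) (b d : ℕ) (s : ∀ i, i ≤ m → M.X i) : Prop where
  forward : ∀ (i : ℕ) (hi : i < m) (hf : fwd i), b ≤ i → i < d →
    M.forward i hi hf (s i hi.le) = s (i + 1) hi
  backward : ∀ (i : ℕ) (hi : i < m) (hf : ¬ fwd i), b ≤ i → i < d →
    M.backward i hi hf (s (i + 1) hi) = s i hi.le

/-- A cosection of `M` over `[b,d]`: linear forms `φ i`, `i ∈ [b,d]`, compatible with the arrows,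
that is, a linear form on the colimit of the restriction of `M` to `[b,d]`. -/
structure IsCosection (M : ZigzagModule m fwd) (b d : ℕ)
    (φ : ∀ i, i ≤ m → M.X i →ₗ[ZMod 2] ZMod 2) : Prop where
  forward : ∀ (i : ℕ) (hi : i < m) (hf : fwd i), b ≤ i → i < d → ∀ x,
    φ (i + 1) hi (M.forward i hi hf x) = φ i hi.le x
  backward : ∀ (i : ℕ) (hi : i < m) (hf : ¬ fwd i), b ≤ i → i < d → ∀ x,
    φ i hi.le (M.backward i hi hf x) = φ (i + 1) hi x

theorem IsSection.map {s : ∀ i, i ≤ m → M.X i} (hs : M.IsSection b d s) (e : Iso M N) :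
    N.IsSection b d fun i hi => e.equiv i hi (s i hi) where
  forward i hi hf hb hd := by rw [← e.comm_forward, hs.forward i hi hf hb hd]
  backward i hi hf hb hd := by rw [← e.comm_backward, hs.backward i hi hf hb hd]

theorem IsCosection.comap {φ : ∀ i, i ≤ m → N.X i →ₗ[ZMod 2] ZMod 2} (hφ : N.IsCosection b d φ)
    (e : Iso M N) : M.IsCosection b d fun i hi => φ i hi ∘ₗ (e.equiv i hi).toLinearMap where
  forward i hi hf hb hd x := by
    simp only [LinearMap.comp_apply, LinearEquiv.coe_coe, e.comm_forward]
    exact hφ.forward i hi hf hb hd _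
  backward i hi hf hb hd x := by
    simp only [LinearMap.comp_apply, LinearEquiv.coe_coe, e.comm_backward]
    exact hφ.backward i hi hf hb hd _

theorem IsCosection.apply_section_eq {φ : ∀ i, i ≤ m → M.X i →ₗ[ZMod 2] ZMod 2}
    (hφ : M.IsCosection b d φ) {s : ∀ i, i ≤ m → M.X i} (hs : M.IsSection b d s) (hdm : d ≤ m)
    {i : ℕ} (hbi : b ≤ i) (hid : i ≤ d) :
    φ i (hid.trans hdm) (s i (hid.trans hdm)) =
      φ b ((hbi.trans hid).trans hdm) (s b ((hbi.trans hid).trans hdm)) := by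
  induction i, hbi using Nat.le_induction with
  | base => rfl
  | succ i hbi ih =>
    rw [← ih (by omega)]
    by_cases hf : fwd i
    · rw [← hs.forward i (by omega) hf hbi hid, hφ.forward i (by omega) hf hbi hid]
    · rw [← hs.backward i (by omega) hf hbi hid, hφ.backward i (by omega) hf hbi hid]

theorem coe_intervalMap {i j : ℕ} (hj : b ≤ j ∧ j ≤ d) (x : intervalSpace b d i) :
    (intervalMap b d i j x : ZMod 2) = x := by
  simp [intervalMap, hj]

theorem intervalSpace_subsingleton {i : ℕ} (hi : ¬ (b ≤ i ∧ i ≤ d)) :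
    Subsingleton (intervalSpace b d i) := by
  rw [intervalSpace, if_neg hi]
  infer_instance

/-- The element of the interval module over `[b,d]` with value `c` at an index `i ∈ [b,d]`. -/
def intervalElem (b d i : ℕ) : ZMod 2 →ₗ[ZMod 2] intervalSpace b d i :=
  if h : b ≤ i ∧ i ≤ d then
    LinearMap.codRestrict _ LinearMap.id fun c => by rw [intervalSpace, if_pos h]; trivial
  else 0

theorem coe_intervalElem {i : ℕ} (hi : b ≤ i ∧ i ≤ d) (c : ZMod 2) :
    (intervalElem b d i c : ZMod 2) = c := by
  simp [intervalElem, hi]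

theorem intervalMap_intervalElem {i j : ℕ} (hi : b ≤ i ∧ i ≤ d) (hj : b ≤ j ∧ j ≤ d)
    (c : ZMod 2) : intervalMap b d i j (intervalElem b d i c) = intervalElem b d j c :=
  Subtype.ext (by rw [coe_intervalMap hj, coe_intervalElem hi, coe_intervalElem hj])

section DirectSum

variable {n : ℕ} (N : Fin n → ZigzagModule m fwd) (k : Fin n)

/-- The inclusion of the summand `N k` into the direct sum, at the index `i`. -/
def inclusion (i : ℕ) : (N k).X i →ₗ[ZMod 2] (directSum N).X i :=
  LinearMap.single (ZMod 2) (fun l => (N l).X i) k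

/-- The projection of the direct sum onto the summand `N k`, at the index `i`. -/
def component (i : ℕ) : (directSum N).X i →ₗ[ZMod 2] (N k).X i :=
  LinearMap.proj (φ := fun l => (N l).X i) k

theorem sum_inclusion_component {i : ℕ} (x : (directSum N).X i) :
    ∑ k, inclusion N k i (component N k i x) = x :=
  LinearMap.sum_single_apply (fun l => (N l).X i) x

theorem forward_inclusion {i : ℕ} (hi : i < m) (hf : fwd i) (x : (N k).X i) :
    (directSum N).forward i hi hf (inclusion N k i x) =
      inclusion N k (i + 1) ((N k).forward i hi hf x) :=
  funext (Pi.apply_single (fun l => (N l).forward i hi hf) (fun _ => map_zero _) k x)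

theorem backward_inclusion {i : ℕ} (hi : i < m) (hf : ¬ fwd i) (x : (N k).X (i + 1)) :
    (directSum N).backward i hi hf (inclusion N k (i + 1) x) =
      inclusion N k i ((N k).backward i hi hf x) :=
  funext (Pi.apply_single (fun l => (N l).backward i hi hf) (fun _ => map_zero _) k x)

variable {N} {k}

theorem isSection_directSum {s : ∀ k i, i ≤ m → (N k).X i} (hs : ∀ k, (N k).IsSection b d (s k)) :
    (directSum N).IsSection b d fun i hi k => s k i hi where
  forward i hi hf hb hd := funext fun k => (hs k).forward i hi hf hb hd
  backward i hi hf hb hd := funext fun k => (hs k).backward i hi hf hb hd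

theorem IsSection.component {s : ∀ i, i ≤ m → (directSum N).X i}
    (hs : (directSum N).IsSection b d s) :
    (N k).IsSection b d fun i hi => component N k i (s i hi) where
  forward i hi hf hb hd := congrFun (hs.forward i hi hf hb hd) k
  backward i hi hf hb hd := congrFun (hs.backward i hi hf hb hd) k

theorem IsCosection.comp_inclusion {φ : ∀ i, i ≤ m → (directSum N).X i →ₗ[ZMod 2] ZMod 2}
    (hφ : (directSum N).IsCosection b d φ) :
    (N k).IsCosection b d fun i hi => φ i hi ∘ₗ inclusion N k i where
  forward i hi hf hb hd x := by
    rw [LinearMap.comp_apply, LinearMap.comp_apply, ← hφ.forward i hi hf hb hd,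
      forward_inclusion]
  backward i hi hf hb hd x := by
    rw [LinearMap.comp_apply, LinearMap.comp_apply, ← hφ.backward i hi hf hb hd,
      backward_inclusion]

theorem IsCosection.comp_component {φ : ∀ i, i ≤ m → (N k).X i →ₗ[ZMod 2] ZMod 2}
    (hφ : (N k).IsCosection b d φ) :
    (directSum N).IsCosection b d fun i hi => φ i hi ∘ₗ ZigzagModule.component N k i where
  forward i hi hf hb hd _ := hφ.forward i hi hf hb hd _
  backward i hi hf hb hd _ := hφ.backward i hi hf hb hd _

end DirectSum

section Uniqueness

variable {n n' : ℕ} {I : Fin n → ℕ × ℕ} {I' : Fin n' → ℕ × ℕ}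

theorem isCosection_subtype {b' d' : ℕ} (hb : b' ≤ b) (hd : d ≤ d') :
    (intervalModule m fwd b' d').IsCosection b d
      fun i _ => (intervalSpace b' d' i).subtype where
  forward _ _ _ hbi hid x := coe_intervalMap ⟨by omega, by omega⟩ x
  backward _ _ _ hbi hid x := coe_intervalMap ⟨by omega, by omega⟩ x

theorem IsCosection.apply_section_eq_zero {b' d' : ℕ}
    {φ : ∀ i, i ≤ m → (intervalModule m fwd b' d').X i →ₗ[ZMod 2] ZMod 2}
    (hφ : (intervalModule m fwd b' d').IsCosection b d φ)
    {s : ∀ i, i ≤ m → (intervalModule m fwd b' d').X i}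
    (hs : (intervalModule m fwd b' d').IsSection b d s) (hbd : b ≤ d) (hdm : d ≤ m)
    (hI : ¬ (b' ≤ b ∧ d ≤ d')) : φ b (hbd.trans hdm) (s b (hbd.trans hdm)) = 0 := by
  obtain ⟨i, hbi, hid, hi⟩ : ∃ i, b ≤ i ∧ i ≤ d ∧ ¬ (b' ≤ i ∧ i ≤ d') := by
    by_cases hb : b' ≤ b
    · exact ⟨d, hbd, le_rfl, by omega⟩
    · exact ⟨b, le_rfl, hbd, by omega⟩
  have : Subsingleton ((intervalModule m fwd b' d').X i) := intervalSpace_subsingleton hi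
  rw [← hφ.apply_section_eq hs hdm hbi hid, Subsingleton.elim (s i _) 0, map_zero]

/-- The direct sum of the interval modules over the intervals `I k`. -/
abbrev intervalSum (m : ℕ) (fwd : ℕ → Prop) (I : Fin n → ℕ × ℕ) : ZigzagModule m fwd :=
  directSum fun k => intervalModule m fwd (I k).1 (I k).2

theorem IsCosection.apply_section_eq_zero_of_component_eq_zero
    {φ : ∀ i, i ≤ m → (intervalSum m fwd I).X i →ₗ[ZMod 2] ZMod 2}
    (hφ : (intervalSum m fwd I).IsCosection b d φ)
    {s : ∀ i, i ≤ m → (intervalSum m fwd I).X i}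
    (hs : (intervalSum m fwd I).IsSection b d s) (hbd : b ≤ d) (hdm : d ≤ m)
    (hzero : ∀ k, (I k).1 ≤ b → d ≤ (I k).2 → component _ k b (s b (hbd.trans hdm)) = 0) :
    φ b (hbd.trans hdm) (s b (hbd.trans hdm)) = 0 := by
  rw [← sum_inclusion_component _ (s b (hbd.trans hdm)), map_sum]
  refine Finset.sum_eq_zero fun k _ => ?_
  by_cases hk : (I k).1 ≤ b ∧ d ≤ (I k).2
  · rw [hzero k hk.1 hk.2, map_zero, map_zero]
  · exact hφ.comp_inclusion.apply_section_eq_zero hs.component hbd hdm hk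

theorem isSection_intervalElem {b' d' : ℕ} {c : ZMod 2} (hc : c ≠ 0 → b' ≤ b ∧ d ≤ d') :
    (intervalModule m fwd b' d').IsSection b d fun i _ => intervalElem b' d' i c := by
  rcases eq_or_ne c 0 with rfl | hc0
  · simp only [map_zero]
    exact ⟨fun _ _ _ _ _ => map_zero _, fun _ _ _ _ _ => map_zero _⟩
  · obtain ⟨hb, hd⟩ := hc hc0
    exact ⟨fun i _ _ _ _ => intervalMap_intervalElem ⟨by omega, by omega⟩ ⟨by omega, by omega⟩ c,
      fun i _ _ _ _ => intervalMap_intervalElem ⟨by omega, by omega⟩ ⟨by omega, by omega⟩ c⟩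

/-- The element of a sum of interval modules at the index `i` with the coefficients `c k`. -/
def intervalSumElem (m : ℕ) (fwd : ℕ → Prop) (I : Fin n → ℕ × ℕ) (i : ℕ) :
    (Fin n → ZMod 2) →ₗ[ZMod 2] (intervalSum m fwd I).X i :=
  LinearMap.pi fun k => intervalElem (I k).1 (I k).2 i ∘ₗ LinearMap.proj k

theorem card_containing_le (e : Iso (intervalSum m fwd I) (intervalSum m fwd I')) (hbd : b ≤ d)
    (hdm : d ≤ m) : Fintype.card {k // (I k).1 ≤ b ∧ d ≤ (I k).2} ≤
      Fintype.card {k // (I' k).1 ≤ b ∧ d ≤ (I' k).2} := by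
  have hbm := hbd.trans hdm
  let coefficients : ({k // (I k).1 ≤ b ∧ d ≤ (I k).2} → ZMod 2) →ₗ[ZMod 2]
      {k // (I' k).1 ≤ b ∧ d ≤ (I' k).2} → ZMod 2 :=
    LinearMap.pi fun k => (intervalSpace (I' k).1 (I' k).2 b).subtype ∘ₗ component _ k.1 b ∘ₗ
      (e.equiv b hbm).toLinearMap ∘ₗ intervalSumElem m fwd I b ∘ₗ
      Function.ExtendByZero.linearMap _ Subtype.val
  have hinj : Function.Injective coefficients := by
    refine (injective_iff_map_eq_zero _).2 fun c hc => funext fun k => ?_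
    have hsection : (intervalSum m fwd I).IsSection b d fun i _ => intervalSumElem m fwd I i
        (Function.extend Subtype.val c 0) :=
      isSection_directSum fun l => isSection_intervalElem fun hl => by
        by_contra hnot
        exact hl (Function.extend_apply' c (0 : Fin n → ZMod 2) l
          fun ⟨l', hl'⟩ => hnot (hl' ▸ l'.2))
    have hcosection := ((isCosection_subtype (m := m) (fwd := fwd) k.2.1 k.2.2).comp_component
      (N := fun k => intervalModule m fwd (I k).1 (I k).2)).comap e.symm
    have hpairing := hcosection.apply_section_eq_zero_of_component_eq_zero (hsection.map e) hbd hdm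
      fun l hb hd => Subtype.ext (congrFun hc ⟨l, hb, hd⟩)
    simp only [LinearMap.comp_apply, LinearEquiv.coe_coe, Iso.symm,
      LinearEquiv.symm_apply_apply] at hpairing
    rw [← Subtype.val_injective.extend_apply c (0 : Fin n → ZMod 2) k]
    exact (coe_intervalElem ⟨k.2.1, hbd.trans k.2.2⟩ _).symm.trans hpairing
  simpa only [Module.finrank_fintype_fun_eq_card] using
    LinearMap.finrank_le_finrank_of_injective hinj

theorem multiset_eq_of_countP_containing_eq {S T : Multiset (ℕ × ℕ)}
    (h : ∀ J ∈ S + T, S.countP (fun I => I.1 ≤ J.1 ∧ J.2 ≤ I.2) =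
      T.countP (fun I => I.1 ≤ J.1 ∧ J.2 ≤ I.2)) : S = T := by
  let containment : PartialOrder (ℕ × ℕ) :=
    { le J I := I.1 ≤ J.1 ∧ J.2 ≤ I.2
      lt J I := (I.1 ≤ J.1 ∧ J.2 ≤ I.2) ∧ ¬ (J.1 ≤ I.1 ∧ I.2 ≤ J.2)
      le_refl _ := ⟨le_rfl, le_rfl⟩
      le_trans _ _ _ hJ hI := ⟨hI.1.trans hJ.1, hJ.2.trans hI.2⟩
      le_antisymm _ _ h h' := Prod.ext (h'.1.antisymm h.1) (h.2.antisymm h'.2) }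
  exact @multiset_eq_of_countP_le_eq _ containment (fun _ _ => instDecidableAnd) S T h

theorem IsBarcode.unique {S T : Multiset (ℕ × ℕ)} (hS : M.IsBarcode S) (hT : M.IsBarcode T) :
    S = T := by
  obtain ⟨n, I, rfl, hI, ⟨e⟩⟩ := hS
  obtain ⟨n', I', rfl, hI', ⟨e'⟩⟩ := hT
  have countP_eq_card : ∀ {n : ℕ} (I : Fin n → ℕ × ℕ) (b d : ℕ),
      (univ.val.map I).countP (fun L => L.1 ≤ b ∧ d ≤ L.2) =
        Fintype.card {k // (I k).1 ≤ b ∧ d ≤ (I k).2} := fun I b d => by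
    rw [Multiset.countP_map, Fintype.card_subtype]
    rfl
  refine multiset_eq_of_countP_containing_eq fun J hJ => ?_
  have hJ : J.1 ≤ J.2 ∧ J.2 ≤ m := by
    rw [Multiset.mem_add, Multiset.mem_map, Multiset.mem_map] at hJ
    rcases hJ with ⟨k, -, rfl⟩ | ⟨k, -, rfl⟩
    exacts [hI k, hI' k]
  rw [countP_eq_card, countP_eq_card]
  exact (card_containing_le (e.symm.trans e') hJ.1 hJ.2).antisymm
    (card_containing_le (e'.symm.trans e) hJ.1 hJ.2)

end Uniqueness
end ZigzagModule

section LinearAlgebra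

variable {E : Type*} [AddCommGroup E] [Module (ZMod 2) E]

/-- The subspace `T` is spanned by `S` and one further vector `x ∉ S`. -/
structure IsSimpleExtension (S T : Submodule (ZMod 2) E) (x : E) : Prop where
  notMem : x ∉ S
  sup_span : S ⊔ Submodule.span (ZMod 2) {x} = T

namespace IsSimpleExtension

variable {S T : Submodule (ZMod 2) E} {x y z : E}

theorem le (h : IsSimpleExtension S T x) : S ≤ T :=
  h.sup_span ▸ le_sup_left

theorem mem (h : IsSimpleExtension S T x) : x ∈ T :=
  h.sup_span ▸ Submodule.mem_sup_right (Submodule.mem_span_singleton_self x)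

theorem lt (h : IsSimpleExtension S T x) : S < T :=
  lt_of_le_not_ge h.le fun hTS => h.notMem (hTS h.mem)

theorem mem_iff (h : IsSimpleExtension S T x) : y ∈ T ↔ y ∈ S ∨ y + x ∈ S := by
  refine ⟨fun hy => ?_, ?_⟩
  · rw [← h.sup_span, Submodule.mem_sup] at hy
    obtain ⟨s, hs, _, hcx, rfl⟩ := hy
    obtain ⟨c, rfl⟩ := Submodule.mem_span_singleton.1 hcx
    rcases (by decide : ∀ c : ZMod 2, c = 0 ∨ c = 1) c with rfl | rfl
    · exact .inl (by simpa using hs)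
    · exact .inr (by rwa [one_smul, add_assoc, ZModModule.add_self, add_zero])
  · rintro (hy | hyx)
    · exact h.le hy
    · exact (T.add_mem_iff_left h.mem).1 (h.le hyx)

theorem add_mem (h : IsSimpleExtension S T x) (hy : y ∈ T) (hyS : y ∉ S) (hz : z ∈ T)
    (hzS : z ∉ S) : y + z ∈ S := by
  have hyx := (h.mem_iff.1 hy).resolve_left hyS
  have hzx := (h.mem_iff.1 hz).resolve_left hzS
  have hsum := S.add_mem hyx hzx
  rwa [add_add_add_comm, ZModModule.add_self, add_zero] at hsum

theorem of_mem (h : IsSimpleExtension S T x) (hy : y ∈ T) (hyS : y ∉ S) :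
    IsSimpleExtension S T y where
  notMem := hyS
  sup_span := by
    refine le_antisymm (sup_le h.le ((Submodule.span_singleton_le_iff_mem _ _).2 hy)) ?_
    rw [← h.sup_span]
    refine sup_le le_sup_left ((Submodule.span_singleton_le_iff_mem _ _).2 ?_)
    rw [Submodule.mem_sup]
    exact ⟨x + y, h.add_mem h.mem h.notMem hy hyS, y, Submodule.mem_span_singleton_self y,
      by rw [add_assoc, ZModModule.add_self, add_zero]⟩

end IsSimpleExtension

variable {ι : Type*} {Z Z' B B' : Submodule (ZMod 2) E} {A : Finset ι} {n : ι} {v v' : ι → E}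

/-- The vectors `v a`, `a ∈ A`, represent a basis of `Z / B`. Over the field with two elements a
linear combination is the sum over a subset of `A`. -/
structure IsBasisMod (Z B : Submodule (ZMod 2) E) (A : Finset ι) (v : ι → E) : Prop where
  mem : ∀ a ∈ A, v a ∈ Z
  span : ∀ x ∈ Z, ∃ S ⊆ A, x + ∑ a ∈ S, v a ∈ B
  indep : ∀ S ⊆ A, ∑ a ∈ S, v a ∈ B → S = ∅

namespace IsBasisMod

theorem sum_mem (h : IsBasisMod Z B A v) {S : Finset ι} (hS : S ⊆ A) : ∑ a ∈ S, v a ∈ Z :=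
  Submodule.sum_mem _ fun a ha => h.mem a (hS ha)

theorem congr (h : IsBasisMod Z B A v) (hB : B ≤ Z) (hv : ∀ a ∈ A, v a + v' a ∈ B) :
    IsBasisMod Z B A v' := by
  have sum_iff : ∀ x, ∀ S ⊆ A, x + ∑ a ∈ S, v a ∈ B ↔ x + ∑ a ∈ S, v' a ∈ B := fun x S hS => by
    have hsum : ∑ a ∈ S, (v a + v' a) ∈ B := Submodule.sum_mem _ fun a ha => hv a (hS ha)
    rw [← B.add_mem_iff_left hsum, sum_add_distrib, add_assoc, ← add_assoc (∑ a ∈ S, v a),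
      ZModModule.add_self, zero_add]
  exact
    { mem := fun a ha => (Z.add_mem_iff_right (h.mem a ha)).1 (hB (hv a ha))
      span := fun x hx => by
        obtain ⟨S, hS, hxS⟩ := h.span x hx
        exact ⟨S, hS, (sum_iff x S hS).1 hxS⟩
      indep := fun S hS hsum => h.indep S hS <| by simpa using (sum_iff 0 S hS).2 (by simpa) }

variable [DecidableEq ι]

theorem insert_of_extension (h : IsBasisMod Z B A v) (hB : B ≤ Z)
    (hZ : IsSimpleExtension Z Z' (v n)) : IsBasisMod Z' B (insert n A) v where
  mem a ha := (mem_insert.1 ha).elim (fun hn => hn ▸ hZ.mem) fun ha => hZ.le (h.mem a ha)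
  span x hx := by
    have hn : n ∉ A := fun hn => hZ.notMem (h.mem n hn)
    rcases hZ.mem_iff.1 hx with hx | hx
    · obtain ⟨S, hS, hxS⟩ := h.span x hx
      exact ⟨S, hS.trans (subset_insert _ _), hxS⟩
    · obtain ⟨S, hS, hxS⟩ := h.span _ hx
      refine ⟨insert n S, insert_subset_insert n hS, ?_⟩
      rwa [sum_insert fun hnS => hn (hS hnS), ← add_assoc]
  indep S hS hsum := by
    by_cases hnS : n ∈ S
    · refine absurd ?_ hZ.notMem
      rw [← add_sum_erase S v hnS] at hsum
      exact (Z.add_mem_iff_left (h.sum_mem (subset_insert_iff.1 hS))).1 (hB hsum)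
    · exact h.indep S ((subset_insert_iff_of_notMem hnS).1 hS) hsum

theorem insert_of_restriction (h : IsBasisMod Z B A v) (hBZ : B ≤ Z) (hn : n ∉ A)
    (hB : IsSimpleExtension B' B (v n)) : IsBasisMod Z B' (insert n A) v where
  mem a ha := (mem_insert.1 ha).elim (fun hn => hn ▸ hBZ hB.mem) (h.mem a)
  span x hx := by
    obtain ⟨S, hS, hxS⟩ := h.span x hx
    rcases hB.mem_iff.1 hxS with hxS | hxS
    · exact ⟨S, hS.trans (subset_insert _ _), hxS⟩
    · refine ⟨insert n S, insert_subset_insert n hS, ?_⟩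
      rwa [sum_insert fun hnS => hn (hS hnS), add_left_comm, add_comm]
  indep S hS hsum := by
    by_cases hnS : n ∈ S
    · rw [← add_sum_erase S v hnS] at hsum
      have herase := h.indep _ (subset_insert_iff.1 hS)
        ((B.add_mem_iff_right hB.mem).1 (hB.le hsum))
      rw [herase, sum_empty, add_zero] at hsum
      exact absurd hsum hB.notMem
    · exact h.indep S ((subset_insert_iff_of_notMem hnS).1 hS) (hB.le hsum)

theorem erase_of_extension (h : IsBasisMod Z B A v) (hn : n ∈ A)
    (hB : IsSimpleExtension B B' (v n)) : IsBasisMod Z B' (A.erase n) v where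
  mem a ha := h.mem a (mem_of_mem_erase ha)
  span x hx := by
    obtain ⟨S, hS, hxS⟩ := h.span x hx
    refine ⟨S.erase n, erase_subset_erase n hS, ?_⟩
    by_cases hnS : n ∈ S
    · rw [← add_sum_erase S v hnS, add_left_comm] at hxS
      exact (B'.add_mem_iff_right hB.mem).1 (hB.le hxS)
    · rw [erase_eq_of_notMem hnS]
      exact hB.le hxS
  indep S hS hsum := by
    have hnS : n ∉ S := fun hnS => notMem_erase n A (hS hnS)
    rcases hB.mem_iff.1 hsum with hsum | hsum
    · exact h.indep S (hS.trans (erase_subset _ _)) hsum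
    · rw [add_comm, ← sum_insert hnS] at hsum
      exact absurd (h.indep _ (insert_subset hn (hS.trans (erase_subset _ _))) hsum)
        (insert_ne_empty _ _)

theorem erase_of_restriction (h : IsBasisMod Z B A v) (hZ : Z' ≤ Z) (hB : B ≤ Z')
    (hn : v n ∉ Z') (hA : ∀ a ∈ A.erase n, v a ∈ Z') : IsBasisMod Z' B (A.erase n) v where
  mem := hA
  span x hx := by
    obtain ⟨S, hS, hxS⟩ := h.span x (hZ hx)
    have hsum := (Z'.add_mem_iff_right hx).1 (hB hxS)
    refine ⟨S, fun a ha => mem_erase.2 ⟨?_, hS ha⟩, hxS⟩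
    rintro rfl
    rw [← add_sum_erase S v ha] at hsum
    exact hn ((Z'.add_mem_iff_left (Submodule.sum_mem _ fun b hb =>
      hA b (erase_subset_erase a hS hb))).1 hsum)
  indep S hS hsum := h.indep S (hS.trans (erase_subset _ _)) hsum

end IsBasisMod

variable {κ : Type*}

theorem sum_smul_eq_sum_filter (A : Finset ι) (c : ι → ZMod 2) (v : ι → E) :
    ∑ a ∈ A, c a • v a = ∑ a ∈ A with c a ≠ 0, v a := by
  rw [sum_filter]
  refine sum_congr rfl fun a _ => ?_
  rcases (by decide : ∀ c : ZMod 2, c = 0 ∨ c = 1) (c a) with h | h <;> simp [h]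

theorem IsBasisMod.comap {A : Finset κ} (e : κ ↪ ι) (h : IsBasisMod Z B (A.map e) v) :
    IsBasisMod Z B A (v ∘ e) where
  mem a ha := h.mem _ (mem_map_of_mem e ha)
  span x hx := by
    obtain ⟨_, hS, hxS⟩ := h.span x hx
    obtain ⟨S, hSA, rfl⟩ := subset_map_iff.1 hS
    exact ⟨S, hSA, by rwa [sum_map] at hxS⟩
  indep S hS hsum :=
    map_eq_empty.1 (h.indep (S.map e) (map_subset_map.2 hS) (by rwa [sum_map]))

theorem IsBasisMod.map {E' : Type*} [AddCommGroup E'] [Module (ZMod 2) E']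
    (h : IsBasisMod Z B A v) {f : E →ₗ[ZMod 2] E'} (hf : ∀ y, ∃ x ∈ Z, f x = y)
    (hker : ∀ x ∈ Z, f x = 0 ↔ x ∈ B) : IsBasisMod ⊤ ⊥ A (f ∘ v) where
  mem _ _ := trivial
  span y _ := by
    obtain ⟨x, hx, rfl⟩ := hf y
    obtain ⟨S, hS, hxS⟩ := h.span x hx
    refine ⟨S, hS, ?_⟩
    have hzero := (hker _ (Z.add_mem hx (h.sum_mem hS))).2 hxS
    rwa [map_add, map_sum] at hzero
  indep S hS hsum := by
    refine h.indep S hS ((hker _ (h.sum_mem hS)).1 ?_)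
    rw [map_sum]
    exact hsum

theorem IsBasisMod.linearIndepOn (h : IsBasisMod Z ⊥ A v) : LinearIndepOn (ZMod 2) v A := by
  rw [linearIndepOn_finset_iff]
  intro c hc a ha
  rw [sum_smul_eq_sum_filter] at hc
  by_contra hca
  exact notMem_empty a (h.indep _ (filter_subset _ _) hc ▸ mem_filter.2 ⟨ha, hca⟩)

theorem IsBasisMod.exists_eq_sum (h : IsBasisMod ⊤ ⊥ A v) (x : E) : ∃ S ⊆ A, x = ∑ a ∈ S, v a := by
  obtain ⟨S, hS, hxS⟩ := h.span x trivial
  exact ⟨S, hS, by rwa [Submodule.mem_bot, ← ZModModule.sub_eq_add, sub_eq_zero] at hxS⟩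

theorem IsBasisMod.finrank_eq (h : IsBasisMod ⊤ ⊥ A v) : Module.finrank (ZMod 2) E = #A := by
  have top_le_span : ⊤ ≤ Submodule.span (ZMod 2) (Set.range fun a : A => v a) := fun x _ => by
    obtain ⟨S, hS, rfl⟩ := h.exists_eq_sum x
    exact Submodule.sum_mem _ fun a ha => Submodule.subset_span ⟨⟨a, hS ha⟩, rfl⟩
  rw [Module.finrank_eq_card_basis (Module.Basis.mk h.linearIndepOn top_le_span)]
  exact Fintype.card_coe A

end LinearAlgebra

namespace ZigzagModule

variable {ι κ : Type*} {m : ℕ} {fwd : ℕ → Prop} {M : ZigzagModule m fwd}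

/-- The indices in `A` of the intervals of a family `I` that contain `α`. -/
def containing (A : Finset ι) (I : ι → ℕ × ℕ) (α : ℕ) : Finset ι :=
  A.filter fun k => (I k).1 ≤ α ∧ α ≤ (I k).2

/-- The elements `v α k` exhibit `M` as the direct sum of the interval modules over `I k`, `k ∈ A`:
at each index `α` those with `α ∈ I k` form a basis, and the arrows match the `v α k` with fixed
`k` as long as they stay in `I k`. The values `v α k` with `α ∉ I k` play no role. -/
structure IsIntervalBasis (M : ZigzagModule m fwd) (A : Finset ι) (I : ι → ℕ × ℕ)
    (v : ∀ α, ι → M.X α) : Prop where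
  valid : ∀ k ∈ A, (I k).1 ≤ (I k).2 ∧ (I k).2 ≤ m
  isBasis : ∀ α ≤ m, IsBasisMod ⊤ ⊥ (containing A I α) (v α)
  forward : ∀ (α : ℕ) (hα : α < m) (hf : fwd α), ∀ k ∈ containing A I α,
    M.forward α hα hf (v α k) = if α + 1 ≤ (I k).2 then v (α + 1) k else 0
  backward : ∀ (α : ℕ) (hα : α < m) (hf : ¬ fwd α), ∀ k ∈ containing A I (α + 1),
    M.backward α hα hf (v (α + 1) k) = if (I k).1 ≤ α then v α k else 0

theorem containing_map (e : κ ↪ ι) (A : Finset κ) (I : ι → ℕ × ℕ) (α : ℕ) :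
    containing (A.map e) I α = (containing A (I ∘ e) α).map e :=
  filter_map

theorem IsIntervalBasis.comap {A : Finset κ} {I : ι → ℕ × ℕ} {v : ∀ α, ι → M.X α} (e : κ ↪ ι)
    (h : M.IsIntervalBasis (A.map e) I v) : M.IsIntervalBasis A (I ∘ e) fun α => v α ∘ e where
  valid _ hk := h.valid _ (mem_map_of_mem e hk)
  isBasis α hα := (containing_map e A I α ▸ h.isBasis α hα).comap e
  forward α hα hf _ hk :=
    h.forward α hα hf _ (containing_map e A I α ▸ mem_map_of_mem e hk)
  backward α hα hf _ hk :=
    h.backward α hα hf _ (containing_map e A I (α + 1) ▸ mem_map_of_mem e hk)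

section Iso

variable {n : ℕ} {I : Fin n → ℕ × ℕ} {v : ∀ α, Fin n → M.X α}

/-- The coordinate with the number `k` of an element of a sum of interval modules, at the index
`i`; it vanishes where the interval `I k` does not contain `i`. -/
def coordinate (m : ℕ) (fwd : ℕ → Prop) (I : Fin n → ℕ × ℕ) (k : Fin n) (i : ℕ) :
    (intervalSum m fwd I).X i →ₗ[ZMod 2] ZMod 2 :=
  (intervalSpace (I k).1 (I k).2 i).subtype ∘ₗ component _ k i

theorem ext_coordinate {i : ℕ} {x y : (intervalSum m fwd I).X i}
    (h : ∀ k, coordinate m fwd I k i x = coordinate m fwd I k i y) : x = y :=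
  funext fun k => Subtype.ext (h k)

theorem coordinate_eq_zero {k : Fin n} {i : ℕ} (hk : k ∉ containing univ I i)
    (x : (intervalSum m fwd I).X i) : coordinate m fwd I k i x = 0 := by
  have : Subsingleton ((intervalModule m fwd (I k).1 (I k).2).X i) :=
    intervalSpace_subsingleton fun h => hk (mem_filter.2 ⟨mem_univ k, h⟩)
  exact congrArg Subtype.val (Subsingleton.elim (component _ k i x) 0)

theorem coordinate_intervalSumElem {k : Fin n} {i : ℕ} (hk : k ∈ containing univ I i)
    (c : Fin n → ZMod 2) : coordinate m fwd I k i (intervalSumElem m fwd I i c) = c k :=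
  coe_intervalElem (mem_filter.1 hk).2 (c k)

theorem coordinate_forward {k : Fin n} {i : ℕ} (hi : i < m) (hf : fwd i)
    (hk : k ∈ containing univ I (i + 1)) (x : (intervalSum m fwd I).X i) :
    coordinate m fwd I k (i + 1) ((intervalSum m fwd I).forward i hi hf x) =
      coordinate m fwd I k i x :=
  coe_intervalMap (mem_filter.1 hk).2 (component _ k i x)

theorem coordinate_backward {k : Fin n} {i : ℕ} (hi : i < m) (hf : ¬ fwd i)
    (hk : k ∈ containing univ I i) (x : (intervalSum m fwd I).X (i + 1)) :
    coordinate m fwd I k i ((intervalSum m fwd I).backward i hi hf x) =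
      coordinate m fwd I k (i + 1) x :=
  coe_intervalMap (mem_filter.1 hk).2 (component _ k (i + 1) x)

/-- The map from a direct sum of interval modules at the index `α` that sends the generators to
`v α k`. -/
def ofIntervalSum (M : ZigzagModule m fwd) (I : Fin n → ℕ × ℕ) (v : ∀ α, Fin n → M.X α) (α : ℕ) :
    (intervalSum m fwd I).X α →ₗ[ZMod 2] M.X α :=
  ∑ k, LinearMap.toSpanSingleton (ZMod 2) _ (v α k) ∘ₗ coordinate m fwd I k α

theorem ofIntervalSum_apply (α : ℕ) (x : (intervalSum m fwd I).X α) :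
    ofIntervalSum M I v α x = ∑ k, coordinate m fwd I k α x • v α k := by
  simp only [ofIntervalSum, LinearMap.sum_apply, LinearMap.comp_apply,
    LinearMap.toSpanSingleton_apply]

theorem ofIntervalSum_eq_sum_containing (α : ℕ) (x : (intervalSum m fwd I).X α) :
    ofIntervalSum M I v α x =
      ∑ k ∈ containing univ I α, coordinate m fwd I k α x • v α k := by
  rw [ofIntervalSum_apply]
  exact (sum_subset (subset_univ _) fun k _ hk => by rw [coordinate_eq_zero hk, zero_smul]).symm

namespace IsIntervalBasis

theorem ofIntervalSum_injective (h : M.IsIntervalBasis univ I v) {α : ℕ} (hα : α ≤ m) :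
    Function.Injective (ofIntervalSum M I v α) := by
  rw [injective_iff_map_eq_zero]
  intro x hx
  rw [ofIntervalSum_eq_sum_containing] at hx
  have hzero := linearIndepOn_finset_iff.1 (h.isBasis α hα).linearIndepOn _ hx
  refine ext_coordinate fun k => ?_
  rw [map_zero]
  exact if hk : k ∈ containing univ I α then hzero k hk else coordinate_eq_zero hk x

theorem ofIntervalSum_surjective (h : M.IsIntervalBasis univ I v) {α : ℕ} (hα : α ≤ m) :
    Function.Surjective (ofIntervalSum M I v α) := fun y => by
  obtain ⟨S, hS, rfl⟩ := (h.isBasis α hα).exists_eq_sum y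
  refine ⟨intervalSumElem m fwd I α fun k => if k ∈ S then 1 else 0, ?_⟩
  rw [ofIntervalSum_eq_sum_containing, ← sum_subset hS]
  · refine sum_congr rfl fun k hk => ?_
    rw [coordinate_intervalSumElem (hS hk), if_pos hk, one_smul]
  · intro k hk hkS
    rw [coordinate_intervalSumElem hk, if_neg hkS, zero_smul]

theorem ofIntervalSum_forward (h : M.IsIntervalBasis univ I v) {α : ℕ} (hα : α < m) (hf : fwd α)
    (x : (intervalSum m fwd I).X α) :
    ofIntervalSum M I v (α + 1) ((intervalSum m fwd I).forward α hα hf x) =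
      M.forward α hα hf (ofIntervalSum M I v α x) := by
  rw [ofIntervalSum_apply, ofIntervalSum_apply, map_sum]
  refine sum_congr rfl fun k _ => ?_
  rw [map_smul]
  by_cases hk' : k ∈ containing univ I (α + 1)
  · rw [coordinate_forward hα hf hk']
    by_cases hk : k ∈ containing univ I α
    · rw [h.forward α hα hf k hk, if_pos (mem_filter.1 hk').2.2]
    · rw [coordinate_eq_zero hk, zero_smul, zero_smul]
  · rw [coordinate_eq_zero hk', zero_smul]
    by_cases hk : k ∈ containing univ I α
    · have hd : ¬ α + 1 ≤ (I k).2 := fun hd => hk' <|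
        mem_filter.2 ⟨mem_univ k, Nat.le_succ_of_le (mem_filter.1 hk).2.1, hd⟩
      rw [h.forward α hα hf k hk, if_neg hd, smul_zero]
    · rw [coordinate_eq_zero hk, zero_smul]

theorem ofIntervalSum_backward (h : M.IsIntervalBasis univ I v) {α : ℕ} (hα : α < m)
    (hf : ¬ fwd α) (x : (intervalSum m fwd I).X (α + 1)) :
    ofIntervalSum M I v α ((intervalSum m fwd I).backward α hα hf x) =
      M.backward α hα hf (ofIntervalSum M I v (α + 1) x) := by
  rw [ofIntervalSum_apply, ofIntervalSum_apply, map_sum]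
  refine sum_congr rfl fun k _ => ?_
  rw [map_smul]
  by_cases hk' : k ∈ containing univ I α
  · rw [coordinate_backward hα hf hk']
    by_cases hk : k ∈ containing univ I (α + 1)
    · rw [h.backward α hα hf k hk, if_pos (mem_filter.1 hk').2.1]
    · rw [coordinate_eq_zero hk, zero_smul, zero_smul]
  · rw [coordinate_eq_zero hk', zero_smul]
    by_cases hk : k ∈ containing univ I (α + 1)
    · have hb : ¬ (I k).1 ≤ α := fun hb => hk' <|
        mem_filter.2 ⟨mem_univ k, hb, Nat.le_of_succ_le (mem_filter.1 hk).2.2⟩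
      rw [h.backward α hα hf k hk, if_neg hb, smul_zero]
    · rw [coordinate_eq_zero hk, zero_smul]

/-- A direct sum of interval modules is isomorphic to any module with an interval basis over the
same intervals. -/
def iso (h : M.IsIntervalBasis univ I v) : Iso (intervalSum m fwd I) M where
  equiv α hα := LinearEquiv.ofBijective (ofIntervalSum M I v α)
    ⟨h.ofIntervalSum_injective hα, h.ofIntervalSum_surjective hα⟩
  comm_forward _ hα hf x := h.ofIntervalSum_forward hα hf x
  comm_backward _ hα hf x := h.ofIntervalSum_backward hα hf x

end IsIntervalBasis

end Iso

theorem IsIntervalBasis.isBarcode {A : Finset ι} {I : ι → ℕ × ℕ} {v : ∀ α, ι → M.X α}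
    (h : M.IsIntervalBasis A I v) : M.IsBarcode (A.val.map I) := by
  let e : Fin #A ↪ ι := A.equivFin.symm.toEmbedding.trans (.subtype _)
  have hA : univ.map e = A := by
    rw [← map_map, map_univ_equiv, univ_eq_attach, attach_map_val]
  have hFin := IsIntervalBasis.comap e (hA.symm ▸ h)
  refine ⟨#A, I ∘ e, ?_, fun k => hFin.valid k (mem_univ k), ⟨hFin.iso.symm⟩⟩
  rw [← Multiset.map_map, ← map_val, hA]

end ZigzagModule

section Bundle

variable {V : Type*} {w : ℕ → Chain V} {J : Finset ℕ} {α : ℕ}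

theorem bundleSum_symmDiff (w : ℕ → Chain V) (J J' : Finset ℕ) (α : ℕ) :
    bundleSum w (symmDiff J J') α = bundleSum w J α + bundleSum w J' α := by
  simp only [bundleSum, sum_filter]
  rw [← sum_inter_add_sum_sdiff J J', ← sum_inter_add_sum_sdiff J' J, inter_comm J' J,
    add_add_add_comm, ZModModule.add_self, zero_add, symmDiff, sup_eq_union,
    sum_union disjoint_sdiff_sdiff]

theorem bundleSum_succ (w : ℕ → Chain V) (J : Finset ℕ) (α : ℕ) :
    bundleSum w J (α + 1) = bundleSum w J α + if α + 1 ∈ J then w (α + 1) else 0 := by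
  have hle : ∀ j, (if j ≤ α + 1 then w j else 0) =
      (if j ≤ α then w j else 0) + if α + 1 = j then w j else 0 := fun j => by
    rcases lt_trichotomy j (α + 1) with hj | rfl | hj
    · rw [if_pos hj.le, if_pos (Nat.lt_succ_iff.1 hj), if_neg hj.ne', add_zero]
    · simp
    · rw [if_neg hj.not_ge, if_neg fun h => hj.not_ge (Nat.le_succ_of_le h), if_neg hj.ne, add_zero]
  simp only [bundleSum, sum_filter, hle, sum_add_distrib, sum_ite_eq]

theorem bundleSum_succ_of_notMem (h : α + 1 ∉ J) : bundleSum w J (α + 1) = bundleSum w J α := by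
  rw [bundleSum_succ, if_neg h, add_zero]

theorem bundleSum_eq_zero (h : ∀ j ∈ J, α < j) : bundleSum w J α = 0 := by
  rw [bundleSum, filter_false_of_mem fun j hj => not_le.2 (h j hj), sum_empty]

theorem bundleSum_mem {S : Submodule (ZMod 2) (Chain V)} (h : ∀ j ∈ J, w j ∈ S) :
    bundleSum w J α ∈ S :=
  Submodule.sum_mem _ fun j hj => h j (mem_of_mem_filter j hj)

theorem bundleSum_singleton (w : ℕ → Chain V) (b : ℕ) : bundleSum w {b} b = w b := by
  rw [bundleSum, filter_true_of_mem (by simp), sum_singleton]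

end Bundle

section Grading

variable {V : Type*} {p q : ℕ} {x : Chain V} {S T : Submodule (ZMod 2) (Chain V)}

/-- The projection of a chain to its part of dimension `p`. -/
def dimPart (V : Type*) (p : ℕ) : Chain V →ₗ[ZMod 2] Chain V where
  toFun := Finsupp.filter fun σ => σ.card = p + 1
  map_add' _ _ := Finsupp.filter_add
  map_smul' _ _ := Finsupp.filter_smul

theorem dimPart_apply (p : ℕ) (x : Chain V) (σ : Finset V) :
    dimPart V p x σ = if σ.card = p + 1 then x σ else 0 :=
  Finsupp.filter_apply _ _ _

theorem dimPart_of_mem (hx : x ∈ chainsOfDim V p) : dimPart V p x = x := by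
  ext σ
  rw [dimPart_apply, ite_eq_left_iff]
  exact fun hσ => ((Finsupp.mem_supported' _ _).1 hx σ hσ).symm

theorem dimPart_of_mem_of_ne (hx : x ∈ chainsOfDim V q) (hqp : q ≠ p) : dimPart V p x = 0 := by
  ext σ
  rw [dimPart_apply, Finsupp.zero_apply, ite_eq_right_iff]
  exact fun hσ => (Finsupp.mem_supported' _ _).1 hx σ fun hσq =>
    hqp (Nat.succ_injective (hσq.symm.trans hσ))

/-- The subspace `S` is the sum of its homogeneous parts, i.e. it contains the homogeneous parts of
its elements. -/
def IsGraded (S : Submodule (ZMod 2) (Chain V)) : Prop :=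
  ∀ p, ∀ x ∈ S, dimPart V p x ∈ S

theorem IsSimpleExtension.mem_of_isGraded (h : IsSimpleExtension S T x) (hS : IsGraded S)
    (hx : x ∈ chainsOfDim V p) {y : Chain V} (hy : y ∈ T) (hyq : y ∈ chainsOfDim V q)
    (hqp : q ≠ p) : y ∈ S := by
  rcases h.mem_iff.1 hy with hyS | hyx
  · exact hyS
  · have hq := hS q _ hyx
    rwa [map_add, dimPart_of_mem hyq, dimPart_of_mem_of_ne hx hqp.symm, add_zero] at hq

theorem IsBasisMod.exists_homogeneous_sum {Z B : Submodule (ZMod 2) (Chain V)} {ι : Type*}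
    {A : Finset ι} {v : ι → Chain V} (h : IsBasisMod Z B A v) (hB : IsGraded B) {deg : ι → ℕ}
    (hv : ∀ a ∈ A, v a ∈ chainsOfDim V (deg a)) (hxZ : x ∈ Z) (hx : x ∈ chainsOfDim V p) :
    ∃ S ⊆ A, (∀ a ∈ S, deg a = p) ∧ x + ∑ a ∈ S, v a ∈ B := by
  obtain ⟨S, hS, hxS⟩ := h.span x hxZ
  refine ⟨S.filter fun a => deg a = p, (filter_subset _ _).trans hS,
    fun a ha => (mem_filter.1 ha).2, ?_⟩
  have hpart : ∀ a ∈ S, dimPart V p (v a) = if deg a = p then v a else 0 := fun a ha => by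
    split_ifs with hap
    · exact dimPart_of_mem (hap ▸ hv a (hS ha))
    · exact dimPart_of_mem_of_ne (hv a (hS ha)) hap
  have hdim := hB p _ hxS
  rwa [map_add, dimPart_of_mem hx, map_sum, sum_congr rfl hpart, ← sum_filter] at hdim

end Grading

/-- The possible effects of an arrow on a pair of subspaces `B ≤ Z`, which it turns into the pair
`B' ≤ Z'`: at most one of the two subspaces changes, and it gains or loses the vector `w`. -/
inductive Step {E : Type*} [AddCommGroup E] [Module (ZMod 2) E] (Z B Z' B' : Submodule (ZMod 2) E)
    (w : E) : Prop
  | birthExtension (hB : B' = B) (hZ : IsSimpleExtension Z Z' w)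
  | birthRestriction (hZ : Z' = Z) (hB : IsSimpleExtension B' B w)
  | deathExtension (hZ : Z' = Z) (hB : IsSimpleExtension B B' w)
  | deathRestriction (hB : B' = B) (hZ : IsSimpleExtension Z' Z w)
  | const (hZ : Z' = Z) (hB : B' = B)

/-- A zigzag of pairs of graded subspaces `B i ≤ Z i` of the chain space, to be read as the zigzag
of the quotients `Z i / B i`, that starts with `0` and in which the arrow between the indices `i`
and `i + 1` adds or removes the homogeneous chain `w (i + 1)`. The homology module of a filtration
is such a zigzag, and the boundary module is one with `B i = ⊥`. -/
structure PairZigzag (V : Type*) (m : ℕ) where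
  Z : ℕ → Submodule (ZMod 2) (Chain V)
  B : ℕ → Submodule (ZMod 2) (Chain V)
  w : ℕ → Chain V
  B_le : ∀ i, B i ≤ Z i
  Z_zero : Z 0 = ⊥
  Z_graded : ∀ i, IsGraded (Z i)
  B_graded : ∀ i, IsGraded (B i)
  homogeneous : ∀ i < m, ∃ p, w (i + 1) ∈ chainsOfDim V p
  step : ∀ i < m, Step (Z i) (B i) (Z (i + 1)) (B (i + 1)) (w (i + 1))

namespace PairZigzag

variable {V : Type*} {m : ℕ} (D : PairZigzag V m)

/-- A class is born at the arrow `j`. -/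
def BirthAt (j : ℕ) : Prop := ¬ D.Z (j + 1) ≤ D.Z j ∨ ¬ D.B j ≤ D.B (j + 1)

/-- A class dies at the arrow `j`. -/
def DeathAt (j : ℕ) : Prop := ¬ D.Z j ≤ D.Z (j + 1) ∨ ¬ D.B (j + 1) ≤ D.B j

/-- The class of the chain `x` dies at the arrow `j`. -/
def Dies (j : ℕ) (x : Chain V) : Prop :=
  (x ∈ D.Z j ∧ x ∉ D.Z (j + 1)) ∨ (x ∈ D.B (j + 1) ∧ x ∉ D.B j)

/-- A class is born at the index `b` because a boundary is removed, that is, at a backward arrow. -/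
def Back (b : ℕ) : Prop := ¬ D.B (b - 1) ≤ D.B b

open Classical in
/-- The birth indices. -/
def births : Finset ℕ := ((range m).filter D.BirthAt).image fun j => j + 1

theorem succ_mem_births {j : ℕ} : j + 1 ∈ D.births ↔ j < m ∧ D.BirthAt j := by
  simp [births]

theorem mem_births {b : ℕ} : b ∈ D.births ↔ ∃ j < m, D.BirthAt j ∧ j + 1 = b := by
  simp [births, and_assoc]

variable {D}

theorem pos_of_mem_births {b : ℕ} (hb : b ∈ D.births) : 0 < b := by
  obtain ⟨j, -, -, rfl⟩ := D.mem_births.1 hb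
  exact j.succ_pos

theorem Dies.deathAt {j : ℕ} {x : Chain V} (h : D.Dies j x) : D.DeathAt j :=
  h.imp (fun hx hle => hx.2 (hle hx.1)) fun hx hle => hx.2 (hle hx.1)

theorem w_mem_B_of_back {i : ℕ} (hi : i < m) (hback : D.Back (i + 1)) : D.w (i + 1) ∈ D.B i := by
  rcases D.step i hi with ⟨hB, -⟩ | ⟨-, hB⟩ | ⟨-, hB⟩ | ⟨hB, -⟩ | ⟨-, hB⟩
  · exact absurd hB.ge hback
  · exact hB.mem
  · exact absurd hB.le hback
  · exact absurd hB.ge hback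
  · exact absurd hB.ge hback

variable (D)

/-- The chain at the index `α` of the bundle of wires `J`. -/
abbrev z (J : Finset ℕ) (α : ℕ) : Chain V := bundleSum D.w J α

/-- The bundle of wires `J` yields a representative of dimension `p` on `[b,n]` that is born at the
index `b`. The wires of `J` with an index `j > b` start at backward arrows, so that adding them does
not change the class of the representative; if `b` itself belongs to a backward arrow, then `J` has
no wires before `b`. -/
structure IsBar (p n b : ℕ) (J : Finset ℕ) : Prop where
  birth : b ∈ D.births
  le : b ≤ n
  subset : J ⊆ D.births
  le_of_mem : ∀ j ∈ J, j ≤ n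
  homogeneous : ∀ j ∈ J, D.w j ∈ chainsOfDim V p
  cycle : ∀ α, b ≤ α → α ≤ n → D.z J α ∈ D.Z α
  back_of_lt : ∀ j ∈ J, b < j → D.Back j
  forward : ¬ D.Back b → D.z J b ∉ D.Z (b - 1)
  backward : D.Back b → b ∈ J ∧ ∀ j ∈ J, b ≤ j ∧ D.Back j

open Classical in
/-- The order in which bars are absorbed: the bundle of a bar may be added to the bundles of the
bars with a larger key. -/
def key (b : ℕ) : ℤ := if D.Back b then -b else b

variable {D}

theorem key_injective : Function.Injective D.key := fun a b hab => by
  unfold key at hab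
  split_ifs at hab <;> omega

theorem lt_of_key_lt {b b₀ : ℕ} (h : D.key b₀ < D.key b) :
    (D.Back b₀ ∧ b < b₀) ∨ (¬ D.Back b ∧ b₀ < b) := by
  unfold key at h
  split_ifs at h with hb₀ hb hb
  · exact .inl ⟨hb₀, by omega⟩
  · rcases lt_trichotomy b b₀ with hlt | rfl | hlt
    · exact .inl ⟨hb₀, hlt⟩
    · exact absurd hb₀ hb
    · exact .inr ⟨hb, hlt⟩
  · omega
  · exact .inr ⟨hb, by omega⟩

namespace IsBar

variable {p n b b₀ α : ℕ} {J J₀ : Finset ℕ}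

theorem z_mem_chainsOfDim (h : D.IsBar p n b J) : D.z J α ∈ chainsOfDim V p :=
  bundleSum_mem h.homogeneous

theorem z_eq_zero (h : D.IsBar p n b J) (hback : D.Back b) (hα : α < b) : D.z J α = 0 :=
  bundleSum_eq_zero fun j hj => hα.trans_le ((h.backward hback).2 j hj).1

theorem z_birth (h : D.IsBar p n b J) (hback : D.Back b) : D.z J b = D.w b := by
  obtain ⟨j, -, -, rfl⟩ := D.mem_births.1 h.birth
  rw [z, bundleSum_succ, if_pos (h.backward hback).1, ← z, h.z_eq_zero hback j.lt_succ_self,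
    zero_add]

theorem z_succ (h : D.IsBar p n b J) (hα : b ≤ α) (hback : ¬ D.Back (α + 1)) :
    D.z J (α + 1) = D.z J α :=
  bundleSum_succ_of_notMem fun hJ => hback (h.back_of_lt _ hJ (Nat.lt_succ_of_le hα))

theorem z_add_z_succ_mem (h : D.IsBar p n b J) (hb : b ≤ α) (hα : α < m) :
    D.z J α + D.z J (α + 1) ∈ D.B α := by
  rw [z, z, bundleSum_succ, ← add_assoc, ZModModule.add_self, zero_add]
  split_ifs with hJ
  · exact w_mem_B_of_back hα (h.back_of_lt _ hJ (Nat.lt_succ_of_le hb))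
  · exact Submodule.zero_mem _

theorem z_mem_of_key_lt (h₀ : D.IsBar p n b₀ J₀) (hkey : D.key b₀ < D.key b) (hb : b ≤ α)
    (hα : α ≤ n) : D.z J₀ α ∈ D.Z α := by
  rcases le_or_gt b₀ α with hb₀ | hb₀
  · exact h₀.cycle α hb₀ hα
  · rcases lt_of_key_lt hkey with ⟨hback, -⟩ | ⟨-, hlt⟩
    · rw [h₀.z_eq_zero hback hb₀]
      exact Submodule.zero_mem _
    · omega

theorem z_mem_Z_pred_of_key_lt (h₀ : D.IsBar p n b₀ J₀) (hkey : D.key b₀ < D.key b) (hbn : b ≤ n)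
    (hback : ¬ D.Back b) : D.z J₀ b ∈ D.Z (b - 1) := by
  rcases lt_of_key_lt hkey with ⟨hback₀, hlt⟩ | ⟨-, hlt⟩
  · rw [h₀.z_eq_zero hback₀ hlt]
    exact Submodule.zero_mem _
  · obtain ⟨a, rfl⟩ : ∃ a, b = a + 1 := ⟨b - 1, by omega⟩
    rw [h₀.z_succ (Nat.lt_succ_iff.1 hlt) hback]
    exact h₀.cycle a (Nat.lt_succ_iff.1 hlt) (by omega)

theorem add (h : D.IsBar p n b J) (h₀ : D.IsBar p n b₀ J₀) (hkey : D.key b₀ < D.key b) :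
    D.IsBar p n b (symmDiff J J₀) := by
  have forall_mem {P : ℕ → Prop} (hJ : ∀ j ∈ J, P j) (hJ₀ : ∀ j ∈ J₀, P j) :
      ∀ j ∈ symmDiff J J₀, P j := fun j hj =>
    (mem_symmDiff.1 hj).elim (fun hj => hJ j hj.1) fun hj => hJ₀ j hj.1
  refine ⟨h.birth, h.le, forall_mem h.subset h₀.subset, forall_mem h.le_of_mem h₀.le_of_mem,
    forall_mem h.homogeneous h₀.homogeneous, fun α hb hα => ?_,
    forall_mem h.back_of_lt fun j hj hbj => ?_, fun hback => ?_, fun hback => ?_⟩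
  · rw [z, bundleSum_symmDiff]
    exact Submodule.add_mem _ (h.cycle α hb hα) (h₀.z_mem_of_key_lt hkey hb hα)
  · rcases lt_of_key_lt hkey with ⟨hback₀, -⟩ | ⟨-, hlt⟩
    · exact ((h₀.backward hback₀).2 j hj).2
    · exact h₀.back_of_lt j hj (hlt.trans hbj)
  · rw [z, bundleSum_symmDiff, Submodule.add_mem_iff_left _
      (h₀.z_mem_Z_pred_of_key_lt hkey h.le hback)]
    exact h.forward hback
  · obtain ⟨hback₀, hlt⟩ := (lt_of_key_lt hkey).resolve_right fun hb => hb.1 hback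
    have hJ₀ : ∀ j ∈ J₀, b < j ∧ D.Back j := fun j hj =>
      ((h₀.backward hback₀).2 j hj).imp_left hlt.trans_le
    exact ⟨mem_symmDiff.2 (.inl ⟨(h.backward hback).1, fun hb => (hJ₀ b hb).1.false⟩),
      forall_mem (h.backward hback).2 fun j hj => (hJ₀ j hj).imp_left le_of_lt⟩

theorem exists_add_sum (h : D.IsBar p n b J) {K : ℕ → Finset ℕ} {S : Finset ℕ}
    (hS : ∀ a ∈ S, D.IsBar p n a (K a)) (hkey : ∀ a ∈ S, D.key a < D.key b) :
    ∃ J', D.IsBar p n b J' ∧ D.z J' n = D.z J n + ∑ a ∈ S, D.z (K a) n := by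
  induction S using Finset.induction_on with
  | empty => exact ⟨J, h, by simp⟩
  | insert a S ha ih =>
    rw [forall_mem_insert] at hS hkey
    obtain ⟨J', hJ', hz⟩ := ih hS.2 hkey.2
    refine ⟨_, hJ'.add hS.1 hkey.1, ?_⟩
    rw [z, bundleSum_symmDiff, sum_insert ha, add_left_comm, ← hz, add_comm]

theorem extend (h : D.IsBar p n b J) (hz : D.z J n ∈ D.Z (n + 1)) : D.IsBar p (n + 1) b J where
  birth := h.birth
  le := Nat.le_succ_of_le h.le
  subset := h.subset
  le_of_mem j hj := Nat.le_succ_of_le (h.le_of_mem j hj)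
  homogeneous := h.homogeneous
  cycle α hb hα := by
    rcases hα.lt_or_eq with hα | rfl
    · exact h.cycle α hb (Nat.lt_succ_iff.1 hα)
    · rwa [z, bundleSum_succ_of_notMem fun hJ => (h.le_of_mem _ hJ).not_gt n.lt_succ_self]
  back_of_lt := h.back_of_lt
  forward := h.forward
  backward := h.backward

end IsBar

theorem exists_isBar_sum {p n : ℕ} {J : ℕ → Finset ℕ} {S : Finset ℕ} (hS : S.Nonempty)
    (hbar : ∀ a ∈ S, D.IsBar p n a (J a)) :
    ∃ b ∈ S, ∃ J', D.IsBar p n b J' ∧ D.z J' n = ∑ a ∈ S, D.z (J a) n := by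
  obtain ⟨b, hb, hmax⟩ := S.exists_max_image D.key hS
  obtain ⟨J', hJ', hz⟩ := (hbar b hb).exists_add_sum (S := S.erase b)
    (fun a ha => hbar a (mem_of_mem_erase ha)) fun a ha =>
      (hmax a (mem_of_mem_erase ha)).lt_of_ne fun h => ne_of_mem_erase ha (key_injective h)
  exact ⟨b, hb, J', hJ', hz.trans (add_sum_erase S (fun a => D.z (J a) n) hb)⟩

theorem w_mem_Z_of_birthAt {i : ℕ} (hi : i < m) (hb : D.BirthAt i) : D.w (i + 1) ∈ D.Z (i + 1) := by
  rcases D.step i hi with ⟨-, hZ⟩ | ⟨hZ, hB⟩ | ⟨hZ, hB⟩ | ⟨hB, hZ⟩ | ⟨hZ, hB⟩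
  · exact hZ.mem
  · exact hZ ▸ D.B_le i hB.mem
  · exact absurd hb (by simp [BirthAt, hZ, hB.le])
  · exact absurd hb (by simp [BirthAt, hB, hZ.le])
  · exact absurd hb (by simp [BirthAt, hZ, hB])

theorem w_notMem_Z_of_not_back {i : ℕ} (hi : i < m) (hb : D.BirthAt i) (hback : ¬ D.Back (i + 1)) :
    D.w (i + 1) ∉ D.Z i := by
  have hZ : ¬ D.Z (i + 1) ≤ D.Z i := hb.resolve_right hback
  rcases D.step i hi with ⟨-, hZ'⟩ | ⟨hZ', -⟩ | ⟨hZ', -⟩ | ⟨-, hZ'⟩ | ⟨hZ', -⟩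
  · exact hZ'.notMem
  · exact absurd hZ'.le hZ
  · exact absurd hZ'.le hZ
  · exact absurd hZ'.le hZ
  · exact absurd hZ'.le hZ

theorem w_notMem_B_of_back {i : ℕ} (hi : i < m) (hback : D.Back (i + 1)) :
    D.w (i + 1) ∉ D.B (i + 1) := by
  rcases D.step i hi with ⟨hB, -⟩ | ⟨-, hB⟩ | ⟨-, hB⟩ | ⟨hB, -⟩ | ⟨-, hB⟩
  · exact absurd hB.ge hback
  · exact hB.notMem
  · exact absurd hB.le hback
  · exact absurd hB.ge hback
  · exact absurd hB.ge hback

theorem exists_isBar_singleton {i : ℕ} (hi : i < m) (hb : D.BirthAt i) :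
    ∃ p, D.IsBar p (i + 1) (i + 1) {i + 1} := by
  obtain ⟨p, hp⟩ := D.homogeneous i hi
  have hmem : i + 1 ∈ D.births := D.succ_mem_births.2 ⟨hi, hb⟩
  refine ⟨p, hmem, le_rfl, by simpa using hmem, by simp, by simpa using hp, fun α hα hα' => ?_,
    by simp, fun hback => ?_, fun hback => ⟨by simp, by simpa using hback⟩⟩
  · obtain rfl := le_antisymm hα' hα
    rw [z, bundleSum_singleton]
    exact w_mem_Z_of_birthAt hi hb
  · rw [z, bundleSum_singleton]
    exact w_notMem_Z_of_not_back hi hb hback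

variable (D)

/-- The birth indices of the bars `[b, d b]` that contain `α`. -/
def alive (d : ℕ → ℕ) (α : ℕ) : Finset ℕ := D.births.filter fun b => b ≤ α ∧ α ≤ d b

/-- The bars `[b, d b]` with bundles `J b`, for the birth indices `b ≤ i`, decompose the part of the
zigzag up to the index `i`. A bar that has not died before `i` has the provisional right end
`d b = m`. -/
structure IsState (i : ℕ) (d : ℕ → ℕ) (J : ℕ → Finset ℕ) : Prop where
  bar : ∀ b ∈ D.births, b ≤ i → ∃ p, D.IsBar p (min (d b) i) b (J b)
  unborn : ∀ b, i < b → J b = {b} ∧ d b = m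
  le : ∀ b, d b ≤ m
  dies : ∀ b ∈ D.births, d b < m → d b < i ∧ D.Dies (d b) (D.z (J b) (d b))
  unique : ∀ j < i, D.DeathAt j → ∃! b, b ∈ D.births ∧ d b = j

variable {D} {i n α b : ℕ} {d : ℕ → ℕ} {J J' : ℕ → Finset ℕ}

theorem mem_alive : b ∈ D.alive d α ↔ b ∈ D.births ∧ b ≤ α ∧ α ≤ d b := by
  simp [alive]

theorem succ_notMem_alive : α + 1 ∉ D.alive d α := fun h =>
  (mem_alive.1 h).2.1.not_gt α.lt_succ_self

variable (D) in
theorem isState_zero : D.IsState 0 (fun _ => m) fun b => {b} where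
  bar _ hb hb0 := absurd hb0 (pos_of_mem_births hb).not_ge
  unborn _ _ := ⟨rfl, rfl⟩
  le _ := le_rfl
  dies _ _ hm := absurd hm (lt_irrefl m)
  unique j hj := absurd hj j.not_lt_zero

namespace IsState

theorem bar_of_le (h : D.IsState i d J) (hα : α ≤ i) (hb : b ∈ D.alive d α) :
    ∃ p n, α ≤ n ∧ D.IsBar p n b (J b) := by
  obtain ⟨hb, hbα, hαb⟩ := mem_alive.1 hb
  obtain ⟨p, hp⟩ := h.bar b hb (hbα.trans hα)
  exact ⟨p, _, le_min hαb hα, hp⟩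

theorem bar_of_mem_alive (h : D.IsState i d J) (hb : b ∈ D.alive d i) :
    ∃ p, D.IsBar p i b (J b) := by
  obtain ⟨hb, hbi, hib⟩ := mem_alive.1 hb
  simpa [hib] using h.bar b hb hbi

theorem cycle (h : D.IsState i d J) (hα : α ≤ i) (hb : b ∈ D.alive d α) : D.z (J b) α ∈ D.Z α := by
  obtain ⟨p, n, hαn, hp⟩ := h.bar_of_le hα hb
  exact hp.cycle α (mem_alive.1 hb).2.1 hαn

theorem dies_of_eq (h : D.IsState i d J) (hα : α < m) (hb : b ∈ D.births) (hd : d b = α) :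
    D.Dies α (D.z (J b) α) :=
  hd ▸ (h.dies b hb (hd ▸ hα)).2

theorem le_of_lt (h : D.IsState i d J) (hb : b ∈ D.births) (hd : d b < m) : b ≤ d b := by
  have hbi : b ≤ i := not_lt.1 fun hib => hd.ne (h.unborn b hib).2
  obtain ⟨p, hp⟩ := h.bar b hb hbi
  exact hp.le.trans (min_le_left _ _)

theorem ne_of_not_deathAt (h : D.IsState i d J) (hα : α < m) (hdeath : ¬ D.DeathAt α)
    (hb : b ∈ D.births) : d b ≠ α := fun hd =>
  hdeath (h.dies_of_eq hα hb hd).deathAt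

theorem alive_succ_of_const (h : D.IsState i d J) (hα : α < m) (hbirth : ¬ D.BirthAt α)
    (hdeath : ¬ D.DeathAt α) : D.alive d (α + 1) = D.alive d α := by
  refine filter_congr fun b hb => ?_
  have hne := h.ne_of_not_deathAt hα hdeath hb
  have hnew : b ≠ α + 1 := fun hbα => hbirth (D.succ_mem_births.1 (hbα ▸ hb)).2
  omega

theorem alive_succ_of_birthAt (h : D.IsState i d J) (hα : α < i) (hm : α < m)
    (hbirth : D.BirthAt α) (hdeath : ¬ D.DeathAt α) :
    D.alive d (α + 1) = insert (α + 1) (D.alive d α) := by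
  have hmem : α + 1 ∈ D.births := D.succ_mem_births.2 ⟨hm, hbirth⟩
  obtain ⟨p, hp⟩ := h.bar _ hmem hα
  have hle : α + 1 ≤ d (α + 1) := hp.le.trans (min_le_left _ _)
  ext b
  rw [mem_insert, mem_alive, mem_alive]
  refine ⟨fun ⟨hb, hbα, _⟩ => ?_, ?_⟩
  · exact hbα.eq_or_lt.imp_right fun hlt => ⟨hb, Nat.lt_succ_iff.1 hlt, by omega⟩
  · rintro (rfl | ⟨hb, hbα, hαb⟩)
    · exact ⟨hmem, le_rfl, hle⟩
    · have hne := h.ne_of_not_deathAt hm hdeath hb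
      exact ⟨hb, by omega, by omega⟩

theorem exists_alive_succ_of_deathAt (h : D.IsState i d J) (hα : α < i) (hm : α < m)
    (hbirth : ¬ D.BirthAt α) (hdeath : D.DeathAt α) :
    ∃ n ∈ D.alive d α, D.Dies α (D.z (J n) α) ∧ D.alive d (α + 1) = (D.alive d α).erase n := by
  obtain ⟨n, ⟨hn, hdn⟩, hunique⟩ := h.unique α hα hdeath
  refine ⟨n, mem_alive.2 ⟨hn, hdn ▸ h.le_of_lt hn (hdn ▸ hm), hdn.ge⟩, h.dies_of_eq hm hn hdn, ?_⟩
  ext b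
  rw [mem_erase, mem_alive, mem_alive]
  refine ⟨fun ⟨hb, _, _⟩ => ⟨?_, hb, ?_, by omega⟩, fun ⟨hbn, hb, _, _⟩ => ?_⟩
  · rintro rfl
    omega
  · have hnew : b ≠ α + 1 := fun hbα => hbirth (D.succ_mem_births.1 (hbα ▸ hb)).2
    omega
  · have hne : d b ≠ α := fun hd => hbn (hunique b ⟨hb, hd⟩)
    exact ⟨hb, by omega, by omega⟩

theorem isBasisMod_zero (d : ℕ → ℕ) (J : ℕ → Finset ℕ) :
    IsBasisMod (D.Z 0) (D.B 0) (D.alive d 0) fun b => D.z (J b) 0 := by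
  have halive : D.alive d 0 = ∅ := filter_eq_empty_iff.2 fun b hb h =>
    (pos_of_mem_births hb).not_ge h.1
  rw [halive]
  refine ⟨by simp, fun x hx => ⟨∅, le_rfl, ?_⟩, fun S hS _ => subset_empty.1 hS⟩
  rw [D.Z_zero, Submodule.mem_bot] at hx
  simp [hx]

theorem isBasisMod_succ (h : D.IsState i d J) (hα : α < i) (hm : α < m)
    (hbasis : IsBasisMod (D.Z α) (D.B α) (D.alive d α) fun b => D.z (J b) α) :
    IsBasisMod (D.Z (α + 1)) (D.B (α + 1)) (D.alive d (α + 1)) fun b => D.z (J b) (α + 1) := by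
  have z_succ : ¬ D.Back (α + 1) → ∀ b ∈ D.alive d α, D.z (J b) (α + 1) = D.z (J b) α :=
    fun hback b hb =>
      let ⟨_, _, _, hp⟩ := h.bar_of_le hα.le hb
      hp.z_succ (mem_alive.1 hb).2.1 hback
  replace hbasis : IsBasisMod (D.Z α) (D.B α) (D.alive d α) fun b => D.z (J b) (α + 1) :=
    hbasis.congr (D.B_le α) fun b hb =>
      let ⟨_, _, _, hp⟩ := h.bar_of_le hα.le hb
      hp.z_add_z_succ_mem (mem_alive.1 hb).2.1 hm
  rcases D.step α hm with ⟨hB, hZ⟩ | ⟨hZ, hB⟩ | ⟨hZ, hB⟩ | ⟨hB, hZ⟩ | ⟨hZ, hB⟩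
  · have hbirth : D.BirthAt α := .inl hZ.lt.not_ge
    obtain ⟨p, hp⟩ := h.bar _ (D.succ_mem_births.2 ⟨hm, hbirth⟩) hα
    rw [h.alive_succ_of_birthAt hα hm hbirth (by simp [DeathAt, hB, hZ.le]), hB]
    exact hbasis.insert_of_extension (D.B_le α)
      (hZ.of_mem (hp.cycle _ le_rfl hp.le) (hp.forward (not_not.2 hB.ge)))
  · have hbirth : D.BirthAt α := .inr hB.lt.not_ge
    obtain ⟨p, hp⟩ := h.bar _ (D.succ_mem_births.2 ⟨hm, hbirth⟩) hα
    rw [h.alive_succ_of_birthAt hα hm hbirth (by simp [DeathAt, hZ, hB.le]), hZ]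
    refine hbasis.insert_of_restriction (D.B_le α) succ_notMem_alive ?_
    rwa [hp.z_birth hB.lt.not_ge]
  · obtain ⟨n, hn, hdies, halive⟩ := h.exists_alive_succ_of_deathAt hα hm
      (by simp [BirthAt, hZ, hB.le]) (.inr hB.lt.not_ge)
    obtain ⟨hnB', hnB⟩ := hdies.resolve_left fun hx => hx.2 (hZ.ge hx.1)
    rw [halive, hZ]
    refine hbasis.erase_of_extension hn ?_
    rw [z_succ (not_not.2 hB.le) n hn]
    exact hB.of_mem hnB' hnB
  · obtain ⟨n, hn, hdies, halive⟩ := h.exists_alive_succ_of_deathAt hα hm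
      (by simp [BirthAt, hB, hZ.le]) (.inl hZ.lt.not_ge)
    have hnZ := (hdies.resolve_right fun hx => hx.2 (hB.le hx.1)).2
    rw [halive, hB]
    refine hbasis.erase_of_restriction hZ.le (hB ▸ D.B_le (α + 1)) ?_ fun b hb =>
      h.cycle hα (halive ▸ hb)
    rwa [z_succ (not_not.2 hB.ge) n hn]
  · rwa [h.alive_succ_of_const hm (by simp [BirthAt, hZ, hB]) (by simp [DeathAt, hZ, hB]), hZ, hB]

theorem isBasisMod (h : D.IsState i d J) (hi : i ≤ m) :
    ∀ α ≤ i, IsBasisMod (D.Z α) (D.B α) (D.alive d α) fun b => D.z (J b) α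
  | 0, _ => isBasisMod_zero d J
  | α + 1, hα => h.isBasisMod_succ hα (lt_of_lt_of_le hα hi) (h.isBasisMod hi α (Nat.le_of_lt hα))

theorem change (h : D.IsState i d J) (hbar : ∀ b ∈ D.alive d i, ∃ p, D.IsBar p i b (J' b))
    (hJ : ∀ b ∉ D.alive d i, J' b = J b) : D.IsState i d J' where
  bar b hb hbi := by
    by_cases hib : i ≤ d b
    · rw [min_eq_right hib]
      exact hbar b (mem_alive.2 ⟨hb, hbi, hib⟩)
    · rw [hJ b fun hb => hib (mem_alive.1 hb).2.2]
      exact h.bar b hb hbi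
  unborn b hib := by
    rw [hJ b fun hb => (mem_alive.1 hb).2.1.not_gt hib]
    exact h.unborn b hib
  le := h.le
  dies b hb hd := by
    rw [hJ b fun hb' => (mem_alive.1 hb').2.2.not_gt (h.dies b hb hd).1]
    exact h.dies b hb hd
  unique := h.unique

theorem bar_succ (h : D.IsState i d J) (hi : i < m) (hb : b ∈ D.births) (hbi : b ≤ i + 1)
    (hZ : b ∈ D.alive d i → D.z (J b) i ∈ D.Z (i + 1)) :
    ∃ p, D.IsBar p (min (d b) (i + 1)) b (J b) := by
  rcases hbi.eq_or_lt with rfl | hbi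
  · obtain ⟨hJ, hd⟩ := h.unborn _ i.lt_succ_self
    rw [hJ, hd, min_eq_right (Nat.succ_le_of_lt hi)]
    exact exists_isBar_singleton hi (D.succ_mem_births.1 hb).2
  · obtain ⟨p, hp⟩ := h.bar b hb (Nat.lt_succ_iff.1 hbi)
    rcases (h.le b).eq_or_lt with hd | hd
    · rw [hd, min_eq_right hi.le] at hp
      rw [hd, min_eq_right (Nat.succ_le_of_lt hi)]
      exact ⟨p, hp.extend (hZ (mem_alive.2 ⟨hb, Nat.lt_succ_iff.1 hbi, hd ▸ hi.le⟩))⟩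
    · have hdi := (h.dies b hb hd).1
      rw [min_eq_left hdi.le] at hp
      rw [min_eq_left (Nat.le_succ_of_le hdi.le)]
      exact ⟨p, hp⟩

theorem survive (h : D.IsState i d J) (hi : i < m) (hdeath : ¬ D.DeathAt i)
    (hZ : ∀ b ∈ D.alive d i, D.z (J b) i ∈ D.Z (i + 1)) : D.IsState (i + 1) d J where
  bar b hb hbi := h.bar_succ hi hb hbi (hZ b)
  unborn b hib := h.unborn b (Nat.lt_of_succ_lt hib)
  le := h.le
  dies b hb hd := (h.dies b hb hd).imp_left Nat.lt_succ_of_lt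
  unique j hj hjdeath := h.unique j
    ((Nat.lt_succ_iff_lt_or_eq.1 hj).resolve_right fun hji => hdeath (hji ▸ hjdeath)) hjdeath

theorem eq_of_mem_alive (h : D.IsState i d J) (hb : b ∈ D.alive d i) : d b = m := by
  obtain ⟨hb, -, hib⟩ := mem_alive.1 hb
  exact (h.le b).eq_or_lt.resolve_right fun hd => hib.not_gt (h.dies b hb hd).1

theorem kill (h : D.IsState i d J) (hi : i < m) (hn : n ∈ D.alive d i)
    (hdies : D.Dies i (D.z (J n) i))
    (hZ : ∀ b ∈ D.alive d i, b ≠ n → D.z (J b) i ∈ D.Z (i + 1)) :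
    D.IsState (i + 1) (Function.update d n i) J where
  bar b hb hbi := by
    obtain rfl | hbn := eq_or_ne b n
    · rw [Function.update_self, min_eq_left i.le_succ]
      exact h.bar_of_mem_alive hn
    · rw [Function.update_of_ne hbn]
      exact h.bar_succ hi hb hbi fun hb => hZ b hb hbn
  unborn b hib := by
    have hbn : b ≠ n := ((mem_alive.1 hn).2.1.trans_lt (Nat.lt_of_succ_lt hib)).ne'
    rw [Function.update_of_ne hbn]
    exact h.unborn b (Nat.lt_of_succ_lt hib)
  le b := by
    obtain rfl | hbn := eq_or_ne b n
    · exact (Function.update_self b i d).trans_le hi.le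
    · exact (Function.update_of_ne hbn i d).trans_le (h.le b)
  dies b hb hd := by
    obtain rfl | hbn := eq_or_ne b n
    · rw [Function.update_self]
      exact ⟨i.lt_succ_self, hdies⟩
    · rw [Function.update_of_ne hbn] at hd ⊢
      exact (h.dies b hb hd).imp_left Nat.lt_succ_of_lt
  unique j hj hjdeath := by
    rcases Nat.lt_succ_iff_lt_or_eq.1 hj with hji | rfl
    · have hnj : ∀ b, Function.update d n i b = j ↔ d b = j := fun b => by
        obtain rfl | hbn := eq_or_ne b n
        · rw [Function.update_self, h.eq_of_mem_alive hn]
          omega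
        · rw [Function.update_of_ne hbn]
      simpa only [hnj] using h.unique j hji hjdeath
    · refine ⟨n, ⟨(mem_alive.1 hn).1, Function.update_self ..⟩, fun b ⟨hb, hd⟩ => ?_⟩
      by_contra hbn
      rw [Function.update_of_ne hbn] at hd
      exact (h.dies b hb (hd ▸ hi)).1.ne hd

theorem exists_succ_of_extension (h : D.IsState i d J) (hi : i < m) (hZ : D.Z (i + 1) = D.Z i)
    (hB : IsSimpleExtension (D.B i) (D.B (i + 1)) (D.w (i + 1))) :
    ∃ d' J', D.IsState (i + 1) d' J' := by
  obtain ⟨p, hw⟩ := D.homogeneous i hi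
  choose! deg hdeg using fun b => h.bar_of_mem_alive (b := b)
  obtain ⟨S, hS, hSp, hwS⟩ := (h.isBasisMod hi.le i le_rfl).exists_homogeneous_sum (D.B_graded i)
    (fun b hb => (hdeg b hb).z_mem_chainsOfDim) (hZ ▸ D.B_le (i + 1) hB.mem) hw
  have hne : S.Nonempty := by
    rw [nonempty_iff_ne_empty]
    rintro rfl
    exact hB.notMem (by simpa using hwS)
  obtain ⟨n, hn, K, hK, hzK⟩ := exists_isBar_sum hne fun a ha => hSp a ha ▸ hdeg a (hS ha)
  rw [← hzK] at hwS
  have hdies : D.Dies i (D.z K i) :=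
    .inr ⟨((D.B (i + 1)).add_mem_iff_right hB.mem).1 (hB.le hwS),
      fun hz => hB.notMem (((D.B i).add_mem_iff_left hz).1 hwS)⟩
  have hchange : D.IsState i d (Function.update J n K) := by
    refine h.change (fun b hb => ?_) fun b hb =>
      Function.update_of_ne (ne_of_mem_of_not_mem (hS hn) hb).symm ..
    obtain rfl | hbn := eq_or_ne b n
    · rw [Function.update_self]
      exact ⟨p, hK⟩
    · rw [Function.update_of_ne hbn]
      exact h.bar_of_mem_alive hb
  exact ⟨_, _, hchange.kill hi (hS hn) (by rwa [Function.update_self]) fun b hb _ =>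
    hZ ▸ hchange.cycle le_rfl hb⟩

theorem exists_isBar_of_restriction (h : D.IsState i d J) (hi : i < m)
    (hB : D.B (i + 1) = D.B i) (hZ : IsSimpleExtension (D.Z (i + 1)) (D.Z i) (D.w (i + 1))) :
    ∃ p, (∃ b ∈ D.alive d i, D.z (J b) i ∉ D.Z (i + 1)) ∧
      ∀ b ∈ D.alive d i, D.z (J b) i ∉ D.Z (i + 1) → D.IsBar p i b (J b) := by
  obtain ⟨p, hw⟩ := D.homogeneous i hi
  refine ⟨p, ?_, fun b hb hbZ => ?_⟩
  · by_contra! hall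
    obtain ⟨S, hS, hwS⟩ := (h.isBasisMod hi.le i le_rfl).span _ hZ.mem
    refine hZ.notMem (((D.Z (i + 1)).add_mem_iff_left ?_).1 (D.B_le _ (hB ▸ hwS)))
    exact Submodule.sum_mem _ fun b hb => hall b (hS hb)
  · obtain ⟨q, hq⟩ := h.bar_of_mem_alive hb
    obtain rfl | hqp := eq_or_ne q p
    · exact hq
    · exact absurd (hZ.mem_of_isGraded (D.Z_graded _) hw (h.cycle le_rfl hb)
        hq.z_mem_chainsOfDim hqp) hbZ

open Classical in
theorem exists_succ_of_restriction (h : D.IsState i d J) (hi : i < m)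
    (hB : D.B (i + 1) = D.B i) (hZ : IsSimpleExtension (D.Z (i + 1)) (D.Z i) (D.w (i + 1))) :
    ∃ d' J', D.IsState (i + 1) d' J' := by
  obtain ⟨p, ⟨b, hb, hbZ⟩, hbar⟩ := h.exists_isBar_of_restriction hi hB hZ
  let T := (D.alive d i).filter fun b => D.z (J b) i ∉ D.Z (i + 1)
  replace hbar : ∀ a ∈ T, D.IsBar p i a (J a) := fun a ha =>
    hbar a (mem_filter.1 ha).1 (mem_filter.1 ha).2
  obtain ⟨n, hn, hmin⟩ := T.exists_min_image D.key ⟨b, mem_filter.2 ⟨hb, hbZ⟩⟩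
  obtain ⟨hnA, hnZ⟩ := mem_filter.1 hn
  let J' : ℕ → Finset ℕ := fun a => if a ∈ T ∧ a ≠ n then symmDiff (J a) (J n) else J a
  have hchange : D.IsState i d J' := by
    refine h.change (fun a ha => ?_) fun a ha => if_neg fun haT => ha (mem_filter.1 haT.1).1
    by_cases haT : a ∈ T ∧ a ≠ n
    · simp only [J', if_pos haT]
      exact ⟨p, (hbar a haT.1).add (hbar n hn)
        ((hmin a haT.1).lt_of_ne fun hkey => haT.2 (key_injective hkey).symm)⟩
    · simp only [J', if_neg haT]
      exact h.bar_of_mem_alive ha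
  have hJn : J' n = J n := if_neg fun hnT => hnT.2 rfl
  refine ⟨_, _, hchange.kill hi hnA (.inl ⟨hchange.cycle le_rfl hnA, hJn ▸ hnZ⟩) fun a ha han => ?_⟩
  by_cases haT : a ∈ T
  · rw [show J' a = symmDiff (J a) (J n) from if_pos ⟨haT, han⟩, z, bundleSum_symmDiff]
    exact hZ.add_mem (h.cycle le_rfl ha) (mem_filter.1 haT).2 (h.cycle le_rfl hnA) hnZ
  · rw [show J' a = J a from if_neg fun haT' => haT haT'.1]
    exact not_not.1 fun haZ => haT (mem_filter.2 ⟨ha, haZ⟩)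

theorem exists_succ (h : D.IsState i d J) (hi : i < m) : ∃ d' J', D.IsState (i + 1) d' J' := by
  have survive_of_le (hZ : D.Z i ≤ D.Z (i + 1)) (hB : D.B (i + 1) ≤ D.B i) :
      ∃ d' J', D.IsState (i + 1) d' J' :=
    ⟨d, J, h.survive hi (by simp [DeathAt, hZ, hB]) fun b hb => hZ (h.cycle le_rfl hb)⟩
  rcases D.step i hi with ⟨hB, hZ⟩ | ⟨hZ, hB⟩ | ⟨hZ, hB⟩ | ⟨hB, hZ⟩ | ⟨hZ, hB⟩
  · exact survive_of_le hZ.le hB.le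
  · exact survive_of_le hZ.ge hB.le
  · exact h.exists_succ_of_extension hi hZ hB
  · exact h.exists_succ_of_restriction hi hB hZ
  · exact survive_of_le hZ.ge hB.le

end IsState

variable (D) in
theorem exists_isState : ∀ i ≤ m, ∃ d J, D.IsState i d J
  | 0, _ => ⟨_, _, D.isState_zero⟩
  | i + 1, hi =>
    let ⟨_, _, h⟩ := exists_isState i (Nat.le_of_lt hi)
    h.exists_succ hi

variable {fwd : ℕ → Prop} (D)

/-- The zigzag module `M` consists of the quotients `Z i / B i`, with the maps induced by the
inclusions. The map `cls i` sends an element of `Z i` to its class; its values on other chains play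
no role, and it is defined on them only to avoid maps between subtypes. -/
structure Presents (M : ZigzagModule m fwd) (cls : ∀ i, Chain V →ₗ[ZMod 2] M.X i) : Prop where
  Z_le : ∀ i < m, fwd i → D.Z i ≤ D.Z (i + 1)
  B_le : ∀ i < m, fwd i → D.B i ≤ D.B (i + 1)
  Z_ge : ∀ i < m, ¬ fwd i → D.Z (i + 1) ≤ D.Z i
  B_ge : ∀ i < m, ¬ fwd i → D.B (i + 1) ≤ D.B i
  surjective : ∀ i y, ∃ x ∈ D.Z i, cls i x = y
  eq_zero_iff : ∀ i, ∀ x ∈ D.Z i, cls i x = 0 ↔ x ∈ D.B i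
  forward : ∀ (i : ℕ) (hi : i < m) (hf : fwd i), ∀ x ∈ D.Z i,
    M.forward i hi hf (cls i x) = cls (i + 1) x
  backward : ∀ (i : ℕ) (hi : i < m) (hf : ¬ fwd i), ∀ x ∈ D.Z (i + 1),
    M.backward i hi hf (cls (i + 1) x) = cls i x

/-- The bundle `J` yields a representative for the interval `[b, e]`. -/
structure IsRepresentative (b e : ℕ) (J : Finset ℕ) : Prop where
  bar : ∃ p, D.IsBar p e b J
  le : e ≤ m
  dies : e < m → D.Dies e (D.z J e)

open Classical in
/-- The multiset of death indices, for a zigzag with `r` bars that reach the last index `m`. -/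
def deaths (r : ℕ) : Multiset ℕ := ((range m).filter D.DeathAt).val + Multiset.replicate r m

variable {D} {M : ZigzagModule m fwd} {cls : ∀ i, Chain V →ₗ[ZMod 2] M.X i}

namespace Presents

variable {x : Chain V}

theorem not_back (hM : D.Presents M cls) (hi : i < m) (hf : fwd i) : ¬ D.Back (i + 1) :=
  not_not.2 (hM.B_le i hi hf)

theorem back (hM : D.Presents M cls) (hf : ¬ fwd i) (hb : i + 1 ∈ D.births) : D.Back (i + 1) :=
  have ⟨hi, hbirth⟩ := D.succ_mem_births.1 hb
  hbirth.resolve_left (not_not.2 (hM.Z_ge i hi hf))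

theorem mem_B_of_dies (hM : D.Presents M cls) (hi : i < m) (hf : fwd i) (hx : D.Dies i x) :
    x ∈ D.B (i + 1) ∧ x ∉ D.B i :=
  hx.resolve_left fun hZ => hZ.2 (hM.Z_le i hi hf hZ.1)

theorem notMem_Z_of_dies (hM : D.Presents M cls) (hi : i < m) (hf : ¬ fwd i) (hx : D.Dies i x) :
    x ∉ D.Z (i + 1) :=
  (hx.resolve_right fun hB => hB.2 (hM.B_ge i hi hf hB.1)).2

end Presents

namespace IsState

theorem isRepresentative (h : D.IsState m d J) (hb : b ∈ D.births) :
    D.IsRepresentative b (d b) (J b) where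
  bar := by
    obtain ⟨j, hj, -, rfl⟩ := D.mem_births.1 hb
    simpa only [min_eq_left (h.le _)] using h.bar _ hb hj
  le := h.le b
  dies hd := (h.dies b hb hd).2

theorem isIntervalBasis (h : D.IsState m d J) (hM : D.Presents M cls) :
    M.IsIntervalBasis D.births (fun b => (b, d b)) fun α b => cls α (D.z (J b) α) where
  valid b hb := ⟨(h.isRepresentative hb).bar.choose_spec.le, h.le b⟩
  isBasis α hα := (h.isBasisMod le_rfl α hα).map (hM.surjective α) (hM.eq_zero_iff α)
  forward α hα hf b hb := by
    obtain ⟨hbirth, hbα, hαd⟩ := mem_alive.1 hb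
    obtain ⟨p, hbar⟩ := (h.isRepresentative hbirth).bar
    rw [hM.forward α hα hf _ (hbar.cycle α hbα hαd)]
    split_ifs with hd
    · rw [hbar.z_succ hbα (hM.not_back hα hf)]
    · have hdα : d b = α := le_antisymm (Nat.lt_succ_iff.1 (not_le.1 hd)) hαd
      have hB := (hM.mem_B_of_dies hα hf (h.dies_of_eq hα hbirth hdα)).1
      exact (hM.eq_zero_iff _ _ (D.B_le _ hB)).2 hB
  backward α hα hf b hb := by
    obtain ⟨hbirth, hbα, hαd⟩ := mem_alive.1 hb
    obtain ⟨p, hbar⟩ := (h.isRepresentative hbirth).bar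
    rw [hM.backward α hα hf _ (hbar.cycle _ hbα hαd)]
    split_ifs with hb
    · have hB : D.z (J b) (α + 1) + D.z (J b) α ∈ D.B α :=
        add_comm (D.z (J b) α) _ ▸ hbar.z_add_z_succ_mem hb hα
      rw [← sub_eq_zero, ← map_sub, ZModModule.sub_eq_add]
      exact (hM.eq_zero_iff _ _ (D.B_le _ hB)).2 hB
    · obtain rfl : b = α + 1 := by omega
      have hback := hM.back hf hbirth
      have hB := w_mem_B_of_back hα hback
      rw [hbar.z_birth hback]
      exact (hM.eq_zero_iff _ _ (D.B_le _ hB)).2 hB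

theorem map_death (h : D.IsState m d J) : D.births.val.map d = D.deaths #(D.alive d m) := by
  classical
  ext j
  rw [deaths, Multiset.count_add, Multiset.count_replicate, Multiset.count_map]
  change #{b ∈ D.births | j = d b} = _
  split_ifs with hjm
  · subst hjm
    rw [Multiset.count_eq_zero_of_notMem (by simp), zero_add]
    refine congrArg card (filter_congr fun b hb => ?_)
    have hle := (h.isRepresentative hb).bar.choose_spec.le
    have := h.le b
    omega
  · rw [add_zero]
    by_cases hdeath : j < m ∧ D.DeathAt j
    · obtain ⟨b, ⟨hb, hdb⟩, hunique⟩ := h.unique j hdeath.1 hdeath.2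
      rw [Multiset.count_eq_one_of_mem (Finset.nodup _) (by simpa using hdeath), card_eq_one]
      exact ⟨b, eq_singleton_iff_unique_mem.2 ⟨mem_filter.2 ⟨hb, hdb.symm⟩, fun a ha =>
        hunique a ⟨(mem_filter.1 ha).1, (mem_filter.1 ha).2.symm⟩⟩⟩
    · rw [Multiset.count_eq_zero_of_notMem (by simpa using hdeath), card_eq_zero,
        filter_eq_empty_iff]
      rintro b hb rfl
      have hdm : d b < m := (h.le b).lt_of_ne (Ne.symm hjm)
      exact hdeath ⟨hdm, (h.dies b hb hdm).2.deathAt⟩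

end IsState

theorem Presents.exists_barcode (hM : D.Presents M cls) :
    ∃ S : Multiset (ℕ × ℕ), (∀ T, M.IsBarcode T ↔ T = S) ∧ S.map Prod.fst = D.births.val ∧
      S.map Prod.snd = D.deaths (Module.finrank (ZMod 2) (M.X m)) ∧
      ∀ I ∈ S, ∃ J ⊆ D.births, D.IsRepresentative I.1 I.2 J := by
  obtain ⟨d, J, h⟩ := D.exists_isState m le_rfl
  have hbasis := h.isIntervalBasis hM
  refine ⟨_, fun T => ⟨fun hT => hT.unique hbasis.isBarcode, fun hT => hT ▸ hbasis.isBarcode⟩,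
    ?_, ?_, fun I hI => ?_⟩
  · rw [Multiset.map_map]
    exact Multiset.map_id _
  · rw [Multiset.map_map, (hbasis.isBasis m le_rfl).finrank_eq]
    exact h.map_death
  · obtain ⟨b, hb, rfl⟩ := Multiset.mem_map.1 hI
    have hrep := h.isRepresentative hb
    exact ⟨J b, hrep.bar.choose_spec.subset, hrep⟩

end PairZigzag

namespace IsSimpleExtension

variable {E E' : Type*} [AddCommGroup E] [Module (ZMod 2) E] [AddCommGroup E'] [Module (ZMod 2) E']
  {S T : Submodule (ZMod 2) E} {x : E} {f : E →ₗ[ZMod 2] E'}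

theorem map_eq (h : IsSimpleExtension S T x) :
    T.map f = S.map f ⊔ Submodule.span (ZMod 2) {f x} := by
  rw [← h.sup_span, Submodule.map_sup, Submodule.map_span, Set.image_singleton]

theorem map_of_notMem (h : IsSimpleExtension S T x) (hx : f x ∉ S.map f) :
    IsSimpleExtension (S.map f) (T.map f) (f x) :=
  ⟨hx, h.map_eq.symm⟩

theorem map_eq_of_mem_ker (h : IsSimpleExtension S T x) (hx : x ∈ LinearMap.ker f) :
    T.map f = S.map f := by
  rw [h.map_eq, LinearMap.mem_ker.1 hx, Submodule.span_zero_singleton, sup_bot_eq]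

theorem inf_of_mem (h : IsSimpleExtension S T x) {N : Submodule (ZMod 2) E} (hx : x ∈ N) :
    IsSimpleExtension (S ⊓ N) (T ⊓ N) x where
  notMem hxS := h.notMem hxS.1
  sup_span := by
    rw [← h.sup_span, sup_comm, sup_comm S]
    exact (sup_inf_assoc_of_le S ((Submodule.span_singleton_le_iff_mem _ _).2 hx)).symm

theorem inf_ker_eq_of_map_notMem (h : IsSimpleExtension S T x) (hx : f x ∉ S.map f) :
    T ⊓ LinearMap.ker f = S ⊓ LinearMap.ker f := by
  refine le_antisymm (fun y ⟨hyT, hyf⟩ => ⟨?_, hyf⟩) (inf_le_inf_right _ h.le)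
  refine (h.mem_iff.1 hyT).resolve_right fun hyx => hx ⟨y + x, hyx, ?_⟩
  rw [map_add, LinearMap.mem_ker.1 hyf, zero_add]

end IsSimpleExtension

section Boundary

variable {V : Type*} {p : ℕ} {σ : Finset V}

open Classical in
/-- The generator of the simplex `τ`, or `0` if `τ` is empty. -/
def simplexChain (τ : Finset V) : Chain V := if τ.Nonempty then Finsupp.single τ 1 else 0

open Classical in
theorem powersetCard_card_sub_one (hσ : σ.Nonempty) :
    σ.powersetCard (σ.card - 1) = σ.image σ.erase := by
  ext τ
  rw [mem_powersetCard, mem_image]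
  constructor
  · rintro ⟨hτσ, hcard⟩
    have hpos := hσ.card_pos
    have hsdiff : (σ \ τ).card = 1 := by
      rw [card_sdiff_of_subset hτσ]
      omega
    obtain ⟨x, hx⟩ := card_eq_one.1 hsdiff
    have hxσ : x ∈ σ \ τ := hx ▸ mem_singleton_self x
    refine ⟨x, (mem_sdiff.1 hxσ).1, ?_⟩
    rw [← sdiff_singleton_eq_erase, ← hx, Finset.sdiff_sdiff_eq_self hτσ]
  · rintro ⟨x, hx, rfl⟩
    exact ⟨erase_subset _ _, card_erase_of_mem hx⟩

open Classical in
theorem boundaryMap_single (σ : Finset V) :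
    boundaryMap V (Finsupp.single σ 1) = ∑ x ∈ σ, simplexChain (σ.erase x) := by
  rw [boundaryMap, Finsupp.linearCombination_single, one_smul]
  rcases σ.eq_empty_or_nonempty with rfl | hσ
  · simp [filter_singleton]
  · rw [powersetCard_card_sub_one hσ, sum_filter, sum_image (erase_injOn σ)]
    rfl

open Classical in
theorem boundaryMap_simplexChain (σ : Finset V) :
    boundaryMap V (simplexChain σ) = ∑ x ∈ σ, simplexChain (σ.erase x) := by
  rw [← boundaryMap_single, simplexChain]
  split_ifs with hσ
  · rfl
  · rw [not_nonempty_iff_eq_empty.1 hσ, map_zero, boundaryMap_single, sum_empty]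

theorem boundaryMap_boundaryMap (x : Chain V) : boundaryMap V (boundaryMap V x) = 0 := by
  classical
  suffices h : boundaryMap V ∘ₗ boundaryMap V = 0 from LinearMap.congr_fun h x
  refine Finsupp.lhom_ext' fun σ => LinearMap.ext_ring ?_
  change boundaryMap V (boundaryMap V (Finsupp.single σ 1)) = 0
  rw [boundaryMap_single, map_sum, sum_congr rfl fun x _ => boundaryMap_simplexChain _, sum_sigma']
  refine sum_involution (fun v _ => ⟨v.2, v.1⟩) ?_ ?_ ?_ ?_
  · rintro ⟨x, y⟩ -
    rw [erase_right_comm, ZModModule.add_self]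
  · rintro ⟨x, y⟩ hxy - heq
    exact ne_of_mem_erase (mem_sigma.1 hxy).2 (congrArg Sigma.fst heq)
  · rintro ⟨x, y⟩ hxy
    obtain ⟨hx, hy⟩ := mem_sigma.1 hxy
    exact mem_sigma.2 ⟨mem_of_mem_erase hy, mem_erase.2 ⟨(ne_of_mem_erase hy).symm, hx⟩⟩
  · rintro ⟨x, y⟩ -
    rfl

theorem boundaryMap_single_of_card_le_one (hσ : σ.card ≤ 1) :
    boundaryMap V (Finsupp.single σ 1) = 0 := by
  classical
  rw [boundaryMap_single]
  refine sum_eq_zero fun x hx => if_neg ?_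
  rw [not_nonempty_iff_eq_empty, ← card_eq_zero, card_erase_of_mem hx]
  omega

theorem boundaryMap_single_mem_chainsOfDim (hσ : σ.card = p + 2) :
    boundaryMap V (Finsupp.single σ 1) ∈ chainsOfDim V p := by
  classical
  rw [boundaryMap_single]
  refine Submodule.sum_mem _ fun x hx => ?_
  rw [simplexChain]
  split_ifs
  · refine Finsupp.single_mem_supported _ _ ?_
    rw [Set.mem_ofPred_eq, card_erase_of_mem hx, hσ]
    rfl
  · exact Submodule.zero_mem _

theorem dimPart_single (p : ℕ) (σ : Finset V) :
    dimPart V p (Finsupp.single σ 1) = if σ.card = p + 1 then Finsupp.single σ 1 else 0 := by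
  split_ifs with hσ
  · exact Finsupp.filter_single_of_pos _ hσ
  · exact Finsupp.filter_single_of_neg _ hσ

theorem dimPart_mem_chainsOfDim (p : ℕ) (x : Chain V) : dimPart V p x ∈ chainsOfDim V p :=
  (Finsupp.mem_supported' _ _).2 fun σ hσ => (dimPart_apply p x σ).trans (if_neg hσ)

theorem boundaryMap_dimPart_succ (p : ℕ) (x : Chain V) :
    boundaryMap V (dimPart V (p + 1) x) = dimPart V p (boundaryMap V x) := by
  suffices h : boundaryMap V ∘ₗ dimPart V (p + 1) = dimPart V p ∘ₗ boundaryMap V from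
    LinearMap.congr_fun h x
  refine Finsupp.lhom_ext' fun σ => LinearMap.ext_ring ?_
  change boundaryMap V (dimPart V (p + 1) (Finsupp.single σ 1)) =
    dimPart V p (boundaryMap V (Finsupp.single σ 1))
  rw [dimPart_single]
  rcases le_or_gt σ.card 1 with hσ | hσ
  · rw [if_neg (by omega), boundaryMap_single_of_card_le_one hσ, map_zero, map_zero]
  · obtain ⟨q, hq⟩ := Nat.exists_eq_add_of_le' hσ
    split_ifs with hp
    · rw [dimPart_of_mem (boundaryMap_single_mem_chainsOfDim hp)]
    · rw [dimPart_of_mem_of_ne (boundaryMap_single_mem_chainsOfDim hq) (by omega), map_zero]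

theorem boundaryMap_dimPart_zero (x : Chain V) : boundaryMap V (dimPart V 0 x) = 0 := by
  suffices h : boundaryMap V ∘ₗ dimPart V 0 = 0 from LinearMap.congr_fun h x
  refine Finsupp.lhom_ext' fun σ => LinearMap.ext_ring ?_
  change boundaryMap V (dimPart V 0 (Finsupp.single σ 1)) = 0
  rw [dimPart_single]
  split_ifs with hσ
  · exact boundaryMap_single_of_card_le_one hσ.le
  · exact map_zero _

end Boundary

section Groups

variable {V : Type*} {K L : PreAbstractSimplicialComplex V} {w : Chain V}

theorem boundaryMap_mem_chainGroup {x : Chain V} (hx : x ∈ chainGroup K) :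
    boundaryMap V x ∈ chainGroup K := by
  classical
  suffices h : chainGroup K ≤ (chainGroup K).comap (boundaryMap V) from h hx
  refine (Finsupp.supported_eq_span_single _ K.faces).trans_le (Submodule.span_le.2 ?_)
  rintro _ ⟨σ, hσ, rfl⟩
  change boundaryMap V (Finsupp.single σ 1) ∈ chainGroup K
  rw [boundaryMap_single]
  refine Submodule.sum_mem _ fun x _ => ?_
  rw [simplexChain]
  split_ifs with hne
  · exact Finsupp.single_mem_supported _ _
      ((K.isRelLowerSet_faces hσ).2 (erase_subset _ _) hne)
  · exact Submodule.zero_mem _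

theorem boundaryGroup_le_cycleGroup (K : PreAbstractSimplicialComplex V) :
    boundaryGroup K ≤ cycleGroup K := by
  rintro _ ⟨x, hx, rfl⟩
  exact ⟨boundaryMap_mem_chainGroup hx, boundaryMap_boundaryMap x⟩

theorem isGraded_bot : IsGraded (⊥ : Submodule (ZMod 2) (Chain V)) := fun p x hx => by
  rw [(Submodule.mem_bot _).1 hx, map_zero]
  exact Submodule.zero_mem _

theorem isGraded_chainGroup (K : PreAbstractSimplicialComplex V) : IsGraded (chainGroup K) :=
  fun p x hx => (Finsupp.mem_supported' _ _).2 fun σ hσ => by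
    rw [dimPart_apply, (Finsupp.mem_supported' _ _).1 hx σ hσ, ite_self]

theorem isGraded_cycleGroup (K : PreAbstractSimplicialComplex V) : IsGraded (cycleGroup K) := by
  refine fun p x hx => ⟨isGraded_chainGroup K p x hx.1, ?_⟩
  cases p with
  | zero => exact boundaryMap_dimPart_zero x
  | succ p =>
    exact (boundaryMap_dimPart_succ p x).trans <| by rw [LinearMap.mem_ker.1 hx.2, map_zero]

theorem isGraded_boundaryGroup (K : PreAbstractSimplicialComplex V) :
    IsGraded (boundaryGroup K) := by
  rintro p _ ⟨x, hx, rfl⟩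
  exact ⟨_, isGraded_chainGroup K (p + 1) x hx, boundaryMap_dimPart_succ p x⟩

theorem isSimpleExtension_chainGroup {σ : Finset V} (hσ : σ ∉ K.faces)
    (hL : L.faces = insert σ K.faces) :
    IsSimpleExtension (chainGroup K) (chainGroup L) (Finsupp.single σ 1) where
  notMem hmem := one_ne_zero <|
    (Finsupp.single_eq_same (a := σ) (b := (1 : ZMod 2))).symm.trans
      ((Finsupp.mem_supported' _ _).1 hmem σ hσ)
  sup_span := by
    rw [chainGroup, chainGroup, hL, Set.insert_eq, Finsupp.supported_union, sup_comm,
      Finsupp.supported_eq_span_single (ZMod 2) {σ}, Set.image_singleton]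

/-- The homogeneous chain `w` is the new cycle or the new boundary that the complex `L` has in
comparison with its subcomplex `K`. -/
structure IsGenerator (K L : PreAbstractSimplicialComplex V) (w : Chain V) : Prop where
  homogeneous : ∃ p, w ∈ chainsOfDim V p
  isSimpleExtension :
    (boundaryGroup L = boundaryGroup K ∧ IsSimpleExtension (cycleGroup K) (cycleGroup L) w) ∨
    (cycleGroup L = cycleGroup K ∧ IsSimpleExtension (boundaryGroup K) (boundaryGroup L) w)

theorem AddsSimplex.exists_isGenerator (h : AddsSimplex K L) : ∃ w, IsGenerator K L w := by
  obtain ⟨σ, hσK, hL⟩ := h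
  have hC := isSimpleExtension_chainGroup hσK hL
  by_cases hσB : boundaryMap V (Finsupp.single σ 1) ∈ boundaryGroup K
  · obtain ⟨x, hx, hxσ⟩ := hσB
    have hxL : x ∈ chainGroup L := hC.le hx
    have hcycle : Finsupp.single σ 1 + x ∈ cycleGroup L :=
      ⟨Submodule.add_mem _ hC.mem hxL, (map_add _ _ _).trans <| by
        rw [hxσ, ZModModule.add_self]⟩
    obtain ⟨p, hp⟩ : ∃ p, σ.card = p + 1 :=
      Nat.exists_eq_add_of_le' ((L.isRelLowerSet_faces (hL ▸ Set.mem_insert σ _)).1.card_pos)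
    have hw := isGraded_cycleGroup L p _ hcycle
    have hwK : dimPart V p (Finsupp.single σ 1 + x) ∉ chainGroup K := by
      rw [map_add, dimPart_single, if_pos hp,
        Submodule.add_mem_iff_left _ (isGraded_chainGroup K p x hx)]
      exact hC.notMem
    have hCw := hC.of_mem hw.1 hwK
    exact ⟨_, ⟨p, dimPart_mem_chainsOfDim p _⟩,
      .inl ⟨hCw.map_eq_of_mem_ker hw.2, hCw.inf_of_mem hw.2⟩⟩
  · refine ⟨_, ?_, .inr ⟨hC.inf_ker_eq_of_map_notMem hσB, hC.map_of_notMem hσB⟩⟩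
    have hcard : 2 ≤ σ.card := not_lt.1 fun hlt => hσB <| by
      rw [boundaryMap_single_of_card_le_one (Nat.lt_succ_iff.1 hlt)]
      exact Submodule.zero_mem _
    obtain ⟨p, hp⟩ := Nat.exists_eq_add_of_le' hcard
    exact ⟨p, boundaryMap_single_mem_chainsOfDim hp⟩

theorem homologyClass_eq_zero_iff {x : Chain V} (hx : x ∈ cycleGroup K) :
    homologyClass K x hx = 0 ↔ x ∈ boundaryGroup K :=
  Submodule.Quotient.mk_eq_zero (boundariesInCycles K)

theorem homologyClass_eq_iff {x y : Chain V} (hx : x ∈ cycleGroup K) (hy : y ∈ cycleGroup K) :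
    homologyClass K x hx = homologyClass K y hy ↔ x - y ∈ boundaryGroup K :=
  Submodule.Quotient.eq (boundariesInCycles K)

theorem homologyMap_injective_iff (h : K.faces ⊆ L.faces) :
    Function.Injective (homologyMap h) ↔ cycleGroup K ⊓ boundaryGroup L ≤ boundaryGroup K := by
  rw [injective_iff_map_eq_zero]
  refine ⟨fun hinj x hx => (homologyClass_eq_zero_iff hx.1).1 (hinj _
    ((homologyClass_eq_zero_iff (cycleGroup_mono h hx.1)).2 hx.2)), fun hle a => ?_⟩
  obtain ⟨⟨x, hx⟩, rfl⟩ := Submodule.Quotient.mk_surjective _ a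
  exact fun hzero => (homologyClass_eq_zero_iff hx).2
    (hle ⟨hx, (homologyClass_eq_zero_iff (cycleGroup_mono h hx)).1 hzero⟩)

theorem homologyMap_surjective_iff (h : K.faces ⊆ L.faces) :
    Function.Surjective (homologyMap h) ↔ cycleGroup L ≤ cycleGroup K ⊔ boundaryGroup L := by
  refine ⟨fun hsurj x hx => ?_, fun hle a => ?_⟩
  · obtain ⟨a, ha⟩ := hsurj (homologyClass L x hx)
    obtain ⟨⟨y, hy⟩, rfl⟩ := Submodule.Quotient.mk_surjective _ a
    have hxy : x - y ∈ boundaryGroup L := (homologyClass_eq_iff hx _).1 ha.symm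
    exact Submodule.mem_sup.2 ⟨y, hy, x - y, hxy, add_sub_cancel y x⟩
  · obtain ⟨⟨x, hx⟩, rfl⟩ := Submodule.Quotient.mk_surjective _ a
    obtain ⟨y, hy, b, hb, rfl⟩ := Submodule.mem_sup.1 (hle hx)
    exact ⟨homologyClass K y hy, ((homologyClass_eq_iff hx (cycleGroup_mono h hy)).2 <| by
      rwa [add_sub_cancel_left]).symm⟩

theorem boundaryInclusion_surjective_iff (h : K.faces ⊆ L.faces) :
    Function.Surjective (boundaryInclusion h) ↔ boundaryGroup L ≤ boundaryGroup K := by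
  refine ⟨fun hsurj x hx => ?_, fun hle x => ⟨⟨x, hle x.2⟩, rfl⟩⟩
  obtain ⟨y, hy⟩ := hsurj ⟨x, hx⟩
  rw [← show (y : Chain V) = x from congrArg Subtype.val hy]
  exact y.2

namespace IsGenerator

theorem cycleGroup_le_iff (hw : IsGenerator K L w) :
    cycleGroup L ≤ cycleGroup K ↔ ¬ boundaryGroup L ≤ boundaryGroup K := by
  rcases hw.isSimpleExtension with ⟨hB, hZ⟩ | ⟨hZ, hB⟩
  · simp [hB, hZ.lt.not_ge]
  · simp [hZ, hB.lt.not_ge]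

theorem homologyMap_injective_iff (hw : IsGenerator K L w) (h : K.faces ⊆ L.faces) :
    Function.Injective (homologyMap h) ↔ boundaryGroup L ≤ boundaryGroup K := by
  rw [WireZigzag.homologyMap_injective_iff]
  rcases hw.isSimpleExtension with ⟨hB, -⟩ | ⟨hZ, -⟩
  · simp [hB]
  · rw [← hZ, inf_eq_right.2 (boundaryGroup_le_cycleGroup L)]

theorem homologyMap_surjective_iff (hw : IsGenerator K L w) (h : K.faces ⊆ L.faces) :
    Function.Surjective (homologyMap h) ↔ cycleGroup L ≤ cycleGroup K := by
  rw [WireZigzag.homologyMap_surjective_iff]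
  rcases hw.isSimpleExtension with ⟨hB, -⟩ | ⟨hZ, -⟩
  · rw [hB, sup_eq_left.2 (boundaryGroup_le_cycleGroup K)]
  · simp [hZ]

end IsGenerator

end Groups

namespace Filtration

variable {V : Type*} {m : ℕ} (F : Filtration V m)

theorem addsSimplex_of_forward {i : ℕ} (hi : i < m) (hf : F.Forward i) :
    AddsSimplex (F.K i) (F.K (i + 1)) :=
  (F.step i hi).resolve_right fun ⟨_, hσ, heq⟩ => hσ (hf (heq ▸ Set.mem_insert _ _))

theorem addsSimplex_of_not_forward {i : ℕ} (hi : i < m) (hf : ¬ F.Forward i) :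
    AddsSimplex (F.K (i + 1)) (F.K i) :=
  (F.step i hi).resolve_left fun ⟨_, _, heq⟩ => hf ((Set.subset_insert _ _).trans heq.ge)

theorem cycleGroup_zero : cycleGroup (F.K 0) = ⊥ :=
  eq_bot_iff.2 <| inf_le_left.trans <| by rw [chainGroup, F.empty, Finsupp.supported_empty]

/-- For each arrow, between the indices `i` and `i + 1`, the chain `w (i + 1)` is the homogeneous
cycle or boundary by which the two complexes differ. -/
structure IsGenerating (w : ℕ → Chain V) : Prop where
  forward : ∀ i < m, F.Forward i → IsGenerator (F.K i) (F.K (i + 1)) (w (i + 1))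
  backward : ∀ i < m, ¬ F.Forward i → IsGenerator (F.K (i + 1)) (F.K i) (w (i + 1))

theorem exists_isGenerating : ∃ w, F.IsGenerating w := by
  have hex : ∀ i, ∃ x, i < m → (F.Forward i → IsGenerator (F.K i) (F.K (i + 1)) x) ∧
      (¬ F.Forward i → IsGenerator (F.K (i + 1)) (F.K i) x) := fun i => by
    by_cases hi : i < m
    · by_cases hf : F.Forward i
      · obtain ⟨x, hx⟩ := (F.addsSimplex_of_forward hi hf).exists_isGenerator
        exact ⟨x, fun _ => ⟨fun _ => hx, absurd hf⟩⟩
      · obtain ⟨x, hx⟩ := (F.addsSimplex_of_not_forward hi hf).exists_isGenerator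
        exact ⟨x, fun _ => ⟨fun hf' => absurd hf' hf, fun _ => hx⟩⟩
    · exact ⟨0, fun hi' => absurd hi' hi⟩
  choose x hx using hex
  exact ⟨fun j => x (j - 1), fun i hi => (hx i hi).1, fun i hi => (hx i hi).2⟩

variable {F} {w : ℕ → Chain V} {b e i : ℕ} {J : Finset ℕ}

namespace IsGenerating

theorem homogeneous (hw : F.IsGenerating w) (hi : i < m) : ∃ p, w (i + 1) ∈ chainsOfDim V p := by
  by_cases hf : F.Forward i
  · exact (hw.forward i hi hf).homogeneous
  · exact (hw.backward i hi hf).homogeneous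

/-- The zigzag of the pairs `(Z(K i), B(K i))`. -/
def homologyPairs (hw : F.IsGenerating w) : PairZigzag V m where
  Z i := cycleGroup (F.K i)
  B i := boundaryGroup (F.K i)
  w := w
  B_le i := boundaryGroup_le_cycleGroup (F.K i)
  Z_zero := F.cycleGroup_zero
  Z_graded i := isGraded_cycleGroup (F.K i)
  B_graded i := isGraded_boundaryGroup (F.K i)
  homogeneous _ := hw.homogeneous
  step i hi := by
    by_cases hf : F.Forward i
    · rcases (hw.forward i hi hf).isSimpleExtension with ⟨hB, hZ⟩ | ⟨hZ, hB⟩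
      · exact .birthExtension hB hZ
      · exact .deathExtension hZ hB
    · rcases (hw.backward i hi hf).isSimpleExtension with ⟨hB, hZ⟩ | ⟨hZ, hB⟩
      · exact .deathRestriction hB.symm hZ
      · exact .birthRestriction hZ.symm hB

/-- The zigzag of the pairs `(B(K i), 0)`. -/
def boundaryPairs (hw : F.IsGenerating w) : PairZigzag V m where
  Z i := boundaryGroup (F.K i)
  B _ := ⊥
  w := w
  B_le _ := bot_le
  Z_zero := eq_bot_iff.2 ((boundaryGroup_le_cycleGroup _).trans F.cycleGroup_zero.le)
  Z_graded i := isGraded_boundaryGroup (F.K i)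
  B_graded _ := isGraded_bot
  homogeneous _ := hw.homogeneous
  step i hi := by
    by_cases hf : F.Forward i
    · rcases (hw.forward i hi hf).isSimpleExtension with ⟨hB, -⟩ | ⟨-, hB⟩
      · exact .const hB rfl
      · exact .birthExtension rfl hB
    · rcases (hw.backward i hi hf).isSimpleExtension with ⟨hB, -⟩ | ⟨-, hB⟩
      · exact .const hB.symm rfl
      · exact .deathRestriction rfl hB

theorem exists_presents_homologyModule (hw : F.IsGenerating w) :
    ∃ cls, hw.homologyPairs.Presents F.homologyModule cls := by
  have hcls : ∀ i, ∃ f : Chain V →ₗ[ZMod 2] Homology (F.K i),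
      ∀ x (hx : x ∈ cycleGroup (F.K i)), f x = homologyClass (F.K i) x hx := fun i => by
    obtain ⟨f, hf⟩ := LinearMap.exists_extend (boundariesInCycles (F.K i)).mkQ
    exact ⟨f, fun x hx => LinearMap.congr_fun hf ⟨x, hx⟩⟩
  choose cls hcls using hcls
  exact ⟨cls,
    { Z_le := fun i _ hf => cycleGroup_mono hf
      B_le := fun i _ hf => boundaryGroup_mono hf
      Z_ge := fun i hi hf => cycleGroup_mono (F.subset_of_not_forward hi hf)
      B_ge := fun i hi hf => boundaryGroup_mono (F.subset_of_not_forward hi hf)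
      surjective := fun i y => by
        obtain ⟨⟨x, hx⟩, rfl⟩ := Submodule.Quotient.mk_surjective (boundariesInCycles (F.K i)) y
        exact ⟨x, hx, hcls i x hx⟩
      eq_zero_iff := fun i x hx => hcls i x hx ▸ homologyClass_eq_zero_iff hx
      forward := fun i _ hf x hx => (congrArg (homologyMap hf) (hcls i x hx)).trans
        (hcls (i + 1) x (cycleGroup_mono hf hx)).symm
      backward := fun i hi hf x hx =>
        have hsub := F.subset_of_not_forward hi hf
        (congrArg (homologyMap hsub) (hcls (i + 1) x hx)).trans
          (hcls i x (cycleGroup_mono hsub hx)).symm }⟩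

theorem exists_presents_boundaryModule (hw : F.IsGenerating w) :
    ∃ cls, hw.boundaryPairs.Presents F.boundaryModule cls := by
  have hcls : ∀ i, ∃ f : Chain V →ₗ[ZMod 2] boundaryGroup (F.K i),
      ∀ x (hx : x ∈ boundaryGroup (F.K i)), f x = ⟨x, hx⟩ := fun i => by
    obtain ⟨N, hN⟩ := (boundaryGroup (F.K i)).exists_isCompl
    exact ⟨_, fun x hx => Submodule.projectionOnto_apply_left hN ⟨x, hx⟩⟩
  choose cls hcls using hcls
  exact ⟨cls,
    { Z_le := fun i _ hf => boundaryGroup_mono hf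
      B_le := fun _ _ _ => le_rfl
      Z_ge := fun i hi hf => boundaryGroup_mono (F.subset_of_not_forward hi hf)
      B_ge := fun _ _ _ => le_rfl
      surjective := fun i y => ⟨y.1, y.2, hcls i y.1 y.2⟩
      eq_zero_iff := fun i x hx => hcls i x hx ▸ Submodule.mk_eq_zero _ hx
      forward := fun i _ hf x hx => (congrArg (boundaryInclusion hf) (hcls i x hx)).trans
        (hcls (i + 1) x (boundaryGroup_mono hf hx)).symm
      backward := fun i hi hf x hx =>
        have hsub := F.subset_of_not_forward hi hf
        (congrArg (boundaryInclusion hsub) (hcls (i + 1) x hx)).trans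
          (hcls i x (boundaryGroup_mono hsub hx)).symm }⟩

theorem homologyPairs_birthAt_iff_injective (hw : F.IsGenerating w) (hi : i < m)
    (hf : F.Forward i) :
    hw.homologyPairs.BirthAt i ↔ Function.Injective (F.homologyModule.forward i hi hf) := by
  have hgen := hw.forward i hi hf
  refine Iff.trans ?_ (hgen.homologyMap_injective_iff hf).symm
  exact (or_iff_left (not_not.2 (boundaryGroup_mono hf))).trans
    (not_congr hgen.cycleGroup_le_iff |>.trans not_not)

theorem homologyPairs_birthAt_iff_surjective (hw : F.IsGenerating w) (hi : i < m)
    (hf : ¬ F.Forward i) :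
    hw.homologyPairs.BirthAt i ↔ Function.Surjective (F.homologyModule.backward i hi hf) := by
  have hgen := hw.backward i hi hf
  have hsub := F.subset_of_not_forward hi hf
  refine Iff.trans ?_ (hgen.homologyMap_surjective_iff hsub).symm
  exact (or_iff_right (not_not.2 (cycleGroup_mono hsub))).trans hgen.cycleGroup_le_iff.symm

theorem homologyPairs_deathAt_iff (hw : F.IsGenerating w) (hi : i < m) :
    hw.homologyPairs.DeathAt i ↔ ¬ hw.homologyPairs.BirthAt i := by
  unfold PairZigzag.DeathAt PairZigzag.BirthAt homologyPairs
  by_cases hf : F.Forward i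
  · simp [(hw.forward i hi hf).cycleGroup_le_iff, cycleGroup_mono hf, boundaryGroup_mono hf]
  · have hsub := F.subset_of_not_forward hi hf
    simp [(hw.backward i hi hf).cycleGroup_le_iff, cycleGroup_mono hsub, boundaryGroup_mono hsub]

theorem boundaryPairs_birthAt_iff (hw : F.IsGenerating w) (hi : i < m) :
    hw.boundaryPairs.BirthAt i ↔
      ∃ hf : F.Forward i, ¬ Function.Surjective (F.boundaryModule.forward i hi hf) := by
  refine (or_iff_left (not_not.2 le_rfl)).trans ⟨fun hle => ?_, fun ⟨hf, hsurj⟩ =>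
    mt (boundaryInclusion_surjective_iff hf).2 hsurj⟩
  have hf : F.Forward i := by_contra fun hf =>
    hle (boundaryGroup_mono (F.subset_of_not_forward hi hf))
  exact ⟨hf, mt (boundaryInclusion_surjective_iff hf).1 hle⟩

theorem boundaryPairs_deathAt_iff (hw : F.IsGenerating w) (hi : i < m) :
    hw.boundaryPairs.DeathAt i ↔
      ∃ hf : ¬ F.Forward i, ¬ Function.Surjective (F.boundaryModule.backward i hi hf) := by
  refine (or_iff_left (not_not.2 le_rfl)).trans ⟨fun hle => ?_, fun ⟨hf, hsurj⟩ =>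
    mt (boundaryInclusion_surjective_iff (F.subset_of_not_forward hi hf)).2 hsurj⟩
  have hf : ¬ F.Forward i := fun hf => hle (boundaryGroup_mono hf)
  exact ⟨hf, mt (boundaryInclusion_surjective_iff (F.subset_of_not_forward hi hf)).1 hle⟩

theorem homologyBirths_eq (hw : F.IsGenerating w) : F.homologyBirths = hw.homologyPairs.births := by
  classical
  refine congrArg (image _) (filter_congr fun i hi => ?_)
  have hi := mem_range.1 hi
  by_cases hf : F.Forward i
  · simp [hi, hf, hw.homologyPairs_birthAt_iff_injective hi hf]
  · simp [hi, hf, hw.homologyPairs_birthAt_iff_surjective hi hf]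

theorem homologyDeaths_eq (hw : F.IsGenerating w) :
    F.homologyDeaths =
      hw.homologyPairs.deaths (Module.finrank (ZMod 2) (F.homologyModule.X m)) := by
  classical
  refine congrArg (· + _) (congrArg val (filter_congr fun i hi => ?_))
  have hi := mem_range.1 hi
  rw [hw.homologyPairs_deathAt_iff hi]
  by_cases hf : F.Forward i
  · simp [hi, hf, hw.homologyPairs_birthAt_iff_injective hi hf]
  · simp [hi, hf, hw.homologyPairs_birthAt_iff_surjective hi hf]

theorem boundaryBirths_eq (hw : F.IsGenerating w) : F.boundaryBirths = hw.boundaryPairs.births := by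
  classical
  refine congrArg (image _) (filter_congr fun i hi => ?_)
  have hi := mem_range.1 hi
  rw [hw.boundaryPairs_birthAt_iff hi, exists_prop_of_true hi]

theorem boundaryDeaths_eq (hw : F.IsGenerating w) :
    F.boundaryDeaths =
      hw.boundaryPairs.deaths (Module.finrank (ZMod 2) (F.boundaryModule.X m)) := by
  classical
  refine congrArg (· + _) (congrArg val (filter_congr fun i hi => ?_))
  have hi := mem_range.1 hi
  rw [hw.boundaryPairs_deathAt_iff hi, exists_prop_of_true hi]

theorem isWire (hw : F.IsGenerating w) (hi : i ∈ F.homologyBirths ∪ F.boundaryBirths) :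
    F.IsWire i (w i) := by
  refine ⟨hi, ?_⟩
  rw [mem_union, hw.homologyBirths_eq, hw.boundaryBirths_eq] at hi
  rcases hi with hbirths | hbirths <;>
    obtain ⟨j, hj, hbirth, rfl⟩ := (PairZigzag.mem_births _).1 hbirths
  · obtain ⟨cls, hM⟩ := hw.exists_presents_homologyModule
    refine ⟨PairZigzag.w_mem_Z_of_birthAt hj hbirth, j, rfl, ?_⟩
    by_cases hf : F.Forward j
    · exact .inl ⟨hf, PairZigzag.w_notMem_Z_of_not_back hj hbirth (hM.not_back hj hf)⟩
    · have hback := hM.back hf hbirths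
      exact .inr (.inl ⟨hf, PairZigzag.w_mem_B_of_back hj hback,
        PairZigzag.w_notMem_B_of_back hj hback⟩)
  · obtain ⟨hf, -⟩ := (hw.boundaryPairs_birthAt_iff hj).1 hbirth
    have hmem := PairZigzag.w_mem_Z_of_birthAt hj hbirth
    exact ⟨boundaryGroup_le_cycleGroup _ hmem, j, rfl, .inr (.inr ⟨hf, hmem,
      PairZigzag.w_notMem_Z_of_not_back hj hbirth (not_not.2 le_rfl)⟩)⟩

theorem isHomologyRep (hw : F.IsGenerating w) (h : hw.homologyPairs.IsRepresentative b e J)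
    (he : e ∈ F.homologyDeaths) : F.IsHomologyRep b e (bundleSum w J) := by
  obtain ⟨cls, hM⟩ := hw.exists_presents_homologyModule
  obtain ⟨p, hbar⟩ := h.bar
  have hadd : ∀ α, b ≤ α → α < e →
      bundleSum w J α - bundleSum w J (α + 1) ∈ boundaryGroup (F.K α) := fun α hb hα => by
    rw [ZModModule.sub_eq_add]
    exact hbar.z_add_z_succ_mem hb (hα.trans_le h.le)
  exact
    { birth_mem := hw.homologyBirths_eq ▸ hbar.birth
      death_mem := he
      birth_le_death := hbar.le
      death_le := h.le
      cycle := hbar.cycle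
      homogeneous := ⟨p, fun _ _ _ => hbar.z_mem_chainsOfDim⟩
      compat_forward := fun α hb hα hf =>
        (homologyClass_eq_iff _ _).2 (boundaryGroup_mono hf (hadd α hb hα))
      compat_backward := fun α hb hα hf =>
        ((homologyClass_eq_iff _ _).2 (hadd α hb hα)).symm
      birth_forward := by
        rintro j rfl hf
        exact hbar.forward (hM.not_back ((Nat.lt_succ_self j).trans_le (hbar.le.trans h.le)) hf)
      birth_backward := by
        rintro j rfl hf
        have hback := hM.back hf hbar.birth
        have hj : j < m := (Nat.lt_succ_self j).trans_le (hbar.le.trans h.le)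
        have hmem := PairZigzag.w_mem_B_of_back hj hback
        have hnotMem := PairZigzag.w_notMem_B_of_back hj hback
        rw [← hbar.z_birth hback] at hmem hnotMem
        exact ⟨mt (homologyClass_eq_zero_iff _).1 hnotMem, (homologyClass_eq_zero_iff _).2 hmem⟩
      death_backward := fun he hf => hM.notMem_Z_of_dies he hf (h.dies he)
      death_forward := fun he hf =>
        have ⟨hB, hnotMem⟩ := hM.mem_B_of_dies he hf (h.dies he)
        ⟨mt (homologyClass_eq_zero_iff _).1 hnotMem, (homologyClass_eq_zero_iff _).2 hB⟩ }

theorem isBoundaryRep (hw : F.IsGenerating w) (h : hw.boundaryPairs.IsRepresentative b e J)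
    (he : e ∈ F.boundaryDeaths) : F.IsBoundaryRep b e (bundleSum w J) := by
  obtain ⟨cls, hM⟩ := hw.exists_presents_boundaryModule
  obtain ⟨p, hbar⟩ := h.bar
  have not_back : ∀ j, ¬ hw.boundaryPairs.Back j := fun _ => not_not.2 le_rfl
  exact
    { birth_mem := hw.boundaryBirths_eq ▸ hbar.birth
      death_mem := he
      birth_le_death := hbar.le
      death_le := h.le
      boundary := hbar.cycle
      homogeneous := ⟨p, fun _ _ _ => hbar.z_mem_chainsOfDim⟩
      compat := fun α hb _ => hbar.z_succ hb (not_back _)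
      birth := by
        rintro j rfl
        exact hbar.forward (not_back _)
      death := fun he =>
        have ⟨hf, _⟩ := (hw.boundaryPairs_deathAt_iff he).1 (h.dies he).deathAt
        hM.notMem_Z_of_dies he hf (h.dies he) }

theorem exists_homologyBarcode (hw : F.IsGenerating w) :
    ∃ S : Multiset (ℕ × ℕ), (∀ T, F.homologyModule.IsBarcode T ↔ T = S) ∧
      S.map Prod.fst = F.homologyBirths.val ∧ S.map Prod.snd = F.homologyDeaths ∧
      ∀ I ∈ S, ∃ J ⊆ F.homologyBirths, F.IsHomologyRep I.1 I.2 (bundleSum w J) := by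
  obtain ⟨cls, hM⟩ := hw.exists_presents_homologyModule
  obtain ⟨S, hS, hbirths, hdeaths, hrep⟩ := hM.exists_barcode
  rw [← hw.homologyBirths_eq] at hbirths hrep
  rw [← hw.homologyDeaths_eq] at hdeaths
  refine ⟨S, hS, hbirths, hdeaths, fun I hI => ?_⟩
  obtain ⟨J, hJ, hIJ⟩ := hrep I hI
  exact ⟨J, hJ, hw.isHomologyRep hIJ (hdeaths ▸ Multiset.mem_map_of_mem Prod.snd hI)⟩

theorem exists_boundaryBarcode (hw : F.IsGenerating w) :
    ∃ S : Multiset (ℕ × ℕ), (∀ T, F.boundaryModule.IsBarcode T ↔ T = S) ∧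
      S.map Prod.fst = F.boundaryBirths.val ∧ S.map Prod.snd = F.boundaryDeaths ∧
      ∀ I ∈ S, ∃ J ⊆ F.boundaryBirths, F.IsBoundaryRep I.1 I.2 (bundleSum w J) := by
  obtain ⟨cls, hM⟩ := hw.exists_presents_boundaryModule
  obtain ⟨S, hS, hbirths, hdeaths, hrep⟩ := hM.exists_barcode
  rw [← hw.boundaryBirths_eq] at hbirths hrep
  rw [← hw.boundaryDeaths_eq] at hdeaths
  refine ⟨S, hS, hbirths, hdeaths, fun I hI => ?_⟩
  obtain ⟨J, hJ, hIJ⟩ := hrep I hI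
  exact ⟨J, hJ, hw.isBoundaryRep hIJ (hdeaths ▸ Multiset.mem_map_of_mem Prod.snd hI)⟩

end IsGenerating

end Filtration

end WireZigzag

end

theorem mainTheorem1 {V : Type*} {m : ℕ} (F : WireZigzag.Filtration V m) :
    ∃ w : ℕ → WireZigzag.Chain V,
      (∀ i ∈ F.homologyBirths ∪ F.boundaryBirths, F.IsWire i (w i)) ∧
      (∃ SH : Multiset (ℕ × ℕ),
        (∀ T, F.homologyModule.IsBarcode T ↔ T = SH) ∧
        SH.map Prod.fst = F.homologyBirths.val ∧
        SH.map Prod.snd = F.homologyDeaths ∧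
        ∀ I ∈ SH, ∃ J ⊆ F.homologyBirths ∪ F.boundaryBirths,
          F.IsHomologyRep I.1 I.2 (WireZigzag.bundleSum w J)) ∧
      (∃ SB : Multiset (ℕ × ℕ),
        (∀ T, F.boundaryModule.IsBarcode T ↔ T = SB) ∧
        SB.map Prod.fst = F.boundaryBirths.val ∧
        SB.map Prod.snd = F.boundaryDeaths ∧
        ∀ I ∈ SB, ∃ J ⊆ F.homologyBirths ∪ F.boundaryBirths,
          F.IsBoundaryRep I.1 I.2 (WireZigzag.bundleSum w J)) := by
  obtain ⟨w, hw⟩ := F.exists_isGenerating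
  obtain ⟨SH, hSH, hHbirths, hHdeaths, hHrep⟩ := hw.exists_homologyBarcode
  obtain ⟨SB, hSB, hBbirths, hBdeaths, hBrep⟩ := hw.exists_boundaryBarcode
  refine ⟨w, fun i hi => hw.isWire hi, ⟨SH, hSH, hHbirths, hHdeaths, fun I hI => ?_⟩,
    SB, hSB, hBbirths, hBdeaths, fun I hI => ?_⟩
  · obtain ⟨J, hJ, hrep⟩ := hHrep I hI
    exact ⟨J, hJ.trans Finset.subset_union_left, hrep⟩
  · obtain ⟨J, hJ, hrep⟩ := hBrep I hI
    exact ⟨J, hJ.trans Finset.subset_union_right, hrep⟩
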